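/- **Setting.** For $N\ge 1$ let $\mathcal H_N$ have orthonormal basis $|x,E\rangle$, with sites $x\in\{1,2\}$ and energies $E\in\{\frac1N,\frac2N,\dots,1\}$. Let $V$ be the random Hermitian matrix with $\langle 1,E|V|2,E'\rangle=z_{E,E'}=\overline{\langle 2,E'|V|1,E\rangle}$ and all other entries zero, where the $z_{E,E'}$ are independent circular complex Gaussians with $\mathbb E|z_{E,E'}|^2=\frac1N$, $\mathbb E z_{E,E'}^2=0$; the Hamiltonian is $H_0+\lambda V$ with $H_0|x,E\rangle=E|x,E\rangle$. Put $K^0(t;E_0)=e^{-iE_0t}$ and, for $n\ge1$, $$K^n(t;E_0,\dots,E_n)=(-i)^n\int_{s_1,\dots,s_n\ge0,\ s_1+\dots+s_n\le t}e^{-iE_0(t-s_1-\dots-s_n)}e^{-iE_1s_n}\cdots e^{-iE_ns_1}\,ds_1\cdots ds_n .$$ A graph $\pi$ of order $(n,m)$ is a partition of $\{1,\dots,n+m\}$ into pairs. It has a crossing if it has pairs $(i,j),(k,l)$ with $i<k<j<l$, and a nest if it has pairs $(i,j),(k,l)$ with $i<k<l<j\le m$ or $m<i<k<l<j$. It is *nested*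 if it has no crossing and at least one nest. For states $(x'_m,E'_m),\dots,(x'_1,E'_1),(x_0,E_0),(x_1,E_1),\dots,(x_n,E_n)$ in this order let $X_1,\dots,X_{m+n}$ be the matrix elements of $V$ between consecutive states, and $C_\pi=\prod_{(l,p)\in\pi}\mathbb E[X_lX_p]$. For an initial state $\psi^N$ and a site $x_0$ let $$Q^N_\pi(t,\lambda,x_0)=\lambda^{n+m}\sum K^n(t;E_0,E_1,\dots,E_n)\,\overline{K^m(t;E_0,E'_1,\dots,E'_m)}\;|\psi^N(x_n,E_n)|^2\,C_\pi ,$$ the sum being over all the states above with $x_0$ fixed, and $$P^{x_0,M,N}_{1,t}=\sum_{n,m=0}^M\ \sum_{\pi\text{ nested of order }(n,m)}Q^N_\pi(t,\lambda,x_0),$$ the contribution of the nested graphs to the averaged probability of being at $x_0$ at time $t$, expanded up to order $M$ in $\lambda$ in bra and ket. **Initial data.** Fix $\varepsilon>0$. For all large $N$, $\|\psi^N\|=1$ and $\psi^N(x,E)=0$ whenever $E\le\varepsilon$ or $E\ge1-\varepsilon$; moreover, as $N\to\infty$, for each $x$ the measure $\sum_E|\psi^N(x,E)|^2\delta_E$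 converges weakly to a finite measure $\rho_x$ on $\mathbb R$. **Theorem.** There is a constant $C>0$ depending only on $\varepsilon$ such that, for all such initial data, the following hold. 1. For every nested graph $\pi$ of order $(n,m)$, every site $x$, $t\ge0$ and $\lambda\in\mathbb R$, the limit $Q_\pi(t,\lambda,x)=\lim_{N\to\infty}Q^N_\pi(t,\lambda,x)$ exists and equals $$\lambda^{n+m}\int K^n\,\overline{K^m},$$ where the energies are identified as $\pi$ prescribes (with the successive energies relabelled $e_0,\dots,e_{n+m}$, a pair $(i,j)$ of $\pi$ gives $e_{i-1}=e_j$ and $e_i=e_{j-1}$), the independent energy containing $E_n$ is integrated against $\rho_{x_n}$ ($x_n=x$ for even $n$, the other site for odd $n$), and each other independent energy is integrated over $[0,1]$ with Lebesgue measure. Consequently, for every $M$, $$P^{x,M}_{1,t}:=\lim_{N\to\infty}P^{x,M,N}_{1,t}=\sum_{n,m=0}^M\ \sum_{\pi\text{ nested of order }(n,m)}Q_\pi(t,\lambda,x).$$ 2. For every nested graph $\pi$ of order $(n,m)$, every site $x$, $t\ge2$ and $\lambda\in\mathbb R$, with $T=\lambda^2t$, $$|Q_\pi(t,\lambda,x)|\le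 (CT)^{\frac{n+m}2}\,\frac{(\log t)^{3+\frac{n+m}2}}{t}.$$ 3. For every $M$, $x$ and $T$, if $\lambda=\lambda(t)$ satisfies $\lambda(t)^2t=T$ for all $t>0$, then $\lim_{t\to\infty}P^{x,M}_{1,t}=0$. -/

import Mathlib

open MeasureTheory ProbabilityTheory Filter Topology
open scoped NNReal BoundedContinuousFunction

namespace HoppingModel

/-! ### The model: two sites, `N` equidistant levels per site, Gaussian hopping -/

/-- The `N` energy levels `1/N, 2/N, …, 1` of a site. -/
noncomputable def energy (N : ℕ) (a : Fin N) : ℝ := ((a : ℕ) + 1 : ℝ) / N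

/-- The law of a centred (circular) complex Gaussian `z` with `𝔼 |z|² = v` and `𝔼 z² = 0`:
real and imaginary part are independent with variance `v / 2`. -/
noncomputable def complexGaussian (v : ℝ≥0) : Measure ℂ :=
  ((gaussianReal 0 (v / 2)).prod (gaussianReal 0 (v / 2))).map
    fun p => (p.1 : ℂ) + (p.2 : ℂ) * Complex.I

/-- The law of the off-diagonal block `z` of the interaction: independent entries, each a complex
Gaussian with `𝔼 |z|² = 1 / N`. This is the density proportional to `exp (- (N / 2) Tr V²)`. -/
noncomputable def blockLaw (N : ℕ) : Measure (Fin N → Fin N → ℂ) :=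
  Measure.pi fun _ => Measure.pi fun _ => complexGaussian (1 / (N : ℝ≥0))

/-- The interaction `V`, a Hermitian matrix in the basis `|x, E⟩` whose only non-zero blocks are the
two off-diagonal ones; the two sites are labelled by `Fin 2`. -/
noncomputable def interaction {N : ℕ} (z : Fin N → Fin N → ℂ) :
    Matrix (Fin 2 × Fin N) (Fin 2 × Fin N) ℂ := fun i j =>
  if i.1 = 0 ∧ j.1 = 1 then z i.2 j.2
  else if i.1 = 1 ∧ j.1 = 0 then star (z j.2 i.2)
  else 0

/-- The covariance `𝔼[V i j * V k l]` of two matrix elements of the interaction. -/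
noncomputable def contraction {N : ℕ} (i j k l : Fin 2 × Fin N) : ℂ :=
  ∫ z, interaction z i j * interaction z k l ∂(blockLaw N)

/-! ### The time-ordered propagators -/

/-- `propagator n E t` is
`(-i)ⁿ ∫₀ᵗ ds₁ ∫₀^{t-s₁} ds₂ ⋯ ∫₀^{t-s₁-⋯-sₙ₋₁} dsₙ
  exp(-i E₀ (t - s₁ - ⋯ - sₙ)) exp(-i E₁ sₙ) ⋯ exp(-i Eₙ s₁)`,
written as an iterated integral whose outermost variable `s₁` belongs to the last energy `Eₙ`. -/
noncomputable def propagator : (n : ℕ) → (Fin (n + 1) → ℝ) → ℝ → ℂ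
  | 0, E, t => Complex.exp (-Complex.I * (E 0 : ℂ) * (t : ℂ))
  | n + 1, E, t => -Complex.I * ∫ s in (0 : ℝ)..t,
      Complex.exp (-Complex.I * (E (Fin.last (n + 1)) : ℂ) * (s : ℂ)) *
        propagator n (fun j => E j.castSucc) (t - s)

/-! ### Graphs (Wick pairings) -/

/-- Graphs on `X₁, …, Xₖ`: a pairing is given by the involution without fixed points that sends
each element to its partner. (Positions are counted from `0`.) -/
abbrev Pairing (k : ℕ) : Type :=
  {σ : Equiv.Perm (Fin k) // ∀ i, σ i ≠ i ∧ σ (σ i) = i}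

/-- There are contractions `(i, j)` and `(k, l)` with `i < k < j < l`. -/
def HasCrossing {k : ℕ} (π : Pairing k) : Prop :=
  ∃ a b : Fin k, a < b ∧ b < π.1 a ∧ π.1 a < π.1 b

/-- There are contractions `(i, j)` and `(k, l)` with `i < k < l < j`, all four among the first `m`
elements or all four among the remaining ones. -/
def HasNest (m : ℕ) {k : ℕ} (π : Pairing k) : Prop :=
  ∃ a b : Fin k, a < b ∧ b < π.1 b ∧ π.1 b < π.1 a ∧ ((π.1 a : ℕ) < m ∨ m ≤ (a : ℕ))

/-- Nested graphs: no crossing and at least one nest. The first `m` elements are the primed ones. -/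
def IsNested (m : ℕ) {k : ℕ} (π : Pairing k) : Prop :=
  ¬ HasCrossing π ∧ HasNest m π

/-! ### Histories

A history of order `(n, m)` lists the states
`(x'ₘ, E'ₘ), …, (x'₁, E'₁), (x₀, E₀), (x₁, E₁), …, (xₙ, Eₙ)`
in this order; the common state `(x₀, E₀)` sits at position `m`, and the matrix element number `l`
of the product of `m + n` matrix elements joins the positions `l` and `l + 1`. -/

/-- The position of `(x_j, E_j)`. -/
def ketPos (n m : ℕ) (j : Fin (n + 1)) : Fin (m + n + 1) := ⟨m + j, by omega⟩

/-- The position of `(x'_j, E'_j)`. -/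
def braPos (n m : ℕ) (j : Fin (m + 1)) : Fin (m + n + 1) := ⟨m - j, by omega⟩

/-- The product `Kⁿ(t, E₀, …, Eₙ) * conj Kᵐ(t, E₀, E'₁, …, E'ₘ)` for the energies `e` of a
history. -/
noncomputable def amplitude (n m : ℕ) (t : ℝ) (e : Fin (m + n + 1) → ℝ) : ℂ :=
  propagator n (fun j => e (ketPos n m j)) t * star (propagator m (fun j => e (braPos n m j)) t)

/-- The graph function: the product of the covariances of the contracted matrix elements. -/
noncomputable def graphFunction {N k : ℕ} (π : Pairing k) (h : Fin (k + 1) → Fin 2 × Fin N) : ℂ :=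
  ∏ l : Fin k with l < π.1 l,
    contraction (h l.castSucc) (h l.succ) (h (π.1 l).castSucc) (h (π.1 l).succ)

/-- The contribution of the graph `π` of order `(n, m)` to the averaged probability of being at the
site `x` at time `t`, with coupling `lam`, `N` levels per site and initial state `ψ`. -/
noncomputable def graphContribution {N : ℕ} (ψ : Fin 2 × Fin N → ℂ) {n m : ℕ} (π : Pairing (m + n))
    (x : Fin 2) (t lam : ℝ) : ℂ :=
  (lam : ℂ) ^ (n + m) *
    ∑ h : Fin (m + n + 1) → Fin 2 × Fin N with (h (ketPos n m 0)).1 = x,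
      amplitude n m t (fun i => energy N (h i).2) *
        ((‖ψ (h (ketPos n m (Fin.last n)))‖ ^ 2 : ℝ) : ℂ) * graphFunction π h

open Classical in
/-- The contribution of all nested graphs to the averaged probability, expanded up to order `M` in
the bra and in the ket. -/
noncomputable def nestedContribution {N : ℕ} (ψ : Fin 2 × Fin N → ℂ) (M : ℕ)
    (x : Fin 2) (t lam : ℝ) : ℂ :=
  ∑ n ∈ Finset.range (M + 1), ∑ m ∈ Finset.range (M + 1),
    ∑ π : Pairing (m + n) with IsNested m π, graphContribution ψ π x t lam

/-! ### The limit of infinitely many levels -/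

/-- The independent energy variables of a graph: the positions of a history modulo the
identifications `E_i = E_{j+1}`, `E_{i+1} = E_j` for every contraction of the elements `i`, `j`. -/
def EnergyVar {k : ℕ} (π : Pairing k) : Type :=
  Quot fun a b : Fin (k + 1) => ∃ i : Fin k, a = i.castSucc ∧ b = (π.1 i).succ

/-- The independent energy variable of a position. -/
def EnergyVar.mk {k : ℕ} (π : Pairing k) (i : Fin (k + 1)) : EnergyVar π := Quot.mk _ i

noncomputable instance {k : ℕ} (π : Pairing k) : Fintype (EnergyVar π) :=
  haveI : Finite (EnergyVar π) := inferInstanceAs (Finite (Quot _))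
  Fintype.ofFinite _

open Classical in
/-- The continuum contribution of a graph (for non-crossing graphs the limit `N → ∞`): the
independent energy variable of `Eₙ` is distributed according to the initial energy distribution at
the site `xₙ` (which is `x` for even `n` and the other site for odd `n`), all other ones run over
`[0, 1]` with Lebesgue measure. -/
noncomputable def limitContribution (ρ : Fin 2 → Measure ℝ) {n m : ℕ} (π : Pairing (m + n))
    (x : Fin 2) (t lam : ℝ) : ℂ :=
  (lam : ℂ) ^ (n + m) *
    ∫ ω : EnergyVar π → ℝ, amplitude n m t (fun i => ω (EnergyVar.mk π i))
      ∂(Measure.pi fun v : EnergyVar π =>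
        if v = EnergyVar.mk π (ketPos n m (Fin.last n)) then ρ (if Even n then x else x + 1)
        else volume.restrict (Set.Icc (0 : ℝ) 1))

open Classical in
/-- The total continuum contribution of the nested graphs of order at most `(M, M)`. -/
noncomputable def nestedLimit (ρ : Fin 2 → Measure ℝ) (M : ℕ) (x : Fin 2) (t lam : ℝ) : ℂ :=
  ∑ n ∈ Finset.range (M + 1), ∑ m ∈ Finset.range (M + 1),
    ∑ π : Pairing (m + n) with IsNested m π, limitContribution ρ π x t lam

/-- Admissible initial data: for all large `N` the state `ψ N` is normalised and has no population
within distance `ε` of the edges of the spectrum, and as `N → ∞` the energy distributions at the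
two sites converge weakly to finite measures `ρ 0`, `ρ 1`. -/
structure IsInitialData (ε : ℝ) (ψ : (N : ℕ) → Fin 2 × Fin N → ℂ) (ρ : Fin 2 → Measure ℝ) :
    Prop where
  finite : ∀ x, IsFiniteMeasure (ρ x)
  normalised : ∀ᶠ N in atTop, ∑ i, ‖ψ N i‖ ^ 2 = 1
  edges : ∀ᶠ N in atTop, ∀ (x : Fin 2) (a : Fin N),
    energy N a ≤ ε ∨ 1 - ε ≤ energy N a → ψ N (x, a) = 0
  weak_limit : ∀ (x : Fin 2) (f : ℝ →ᵇ ℝ),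
    Tendsto (fun N => ∑ a, ‖ψ N (x, a)‖ ^ 2 * f (energy N a)) atTop (𝓝 (∫ e, f e ∂(ρ x)))

end HoppingModel

namespace HoppingModel

/-! ### Propagators as integrals over simplices -/

/-- The simplex of nonnegative times with sum at most `t`. -/
def timeSimplex (n : ℕ) (t : ℝ) : Set (Fin n → ℝ) := {s | (∀ i, 0 ≤ s i) ∧ ∑ i, s i ≤ t}

lemma isCompact_timeSimplex (n : ℕ) (t : ℝ) : IsCompact (timeSimplex n t) := by
  refine IsCompact.of_isClosed_subset (isCompact_Icc (a := 0) (b := fun _ => t)) ?_ ?_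
  · simp only [timeSimplex, Set.ofPred_and, Set.ofPred_forall]
    exact (isClosed_iInter fun i => isClosed_le (by fun_prop) (by fun_prop)).inter
      (isClosed_le (by fun_prop) (by fun_prop))
  · rintro s ⟨h0, h1⟩
    exact ⟨h0, fun i => (Finset.single_le_sum (fun j _ => h0 j) (Finset.mem_univ i)).trans h1⟩

/-- The phase accumulated along a time-ordered path, the last time being eliminated. -/
noncomputable def pathPhase (n : ℕ) (E : Fin (n + 1) → ℝ) (t : ℝ) (s : Fin n → ℝ) : ℝ :=
  ∑ j, E j.castSucc * s j + E (Fin.last n) * (t - ∑ j, s j)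

lemma integral_timeSimplex_succ (n : ℕ) (E : Fin (n + 2) → ℝ) {t : ℝ} (ht : 0 ≤ t) :
    ∫ s in timeSimplex (n + 1) t, Complex.exp (-Complex.I * pathPhase (n + 1) E t s) =
      ∫ u in (0 : ℝ)..t, ∫ s in timeSimplex n (t - u), Complex.exp (-Complex.I *
        (E (Fin.last (n + 1)) * u + pathPhase n (fun j => E j.castSucc) (t - u) s : ℝ)) := by
  set S : Set (ℝ × (Fin n → ℝ)) := {p | 0 ≤ p.1 ∧ (∀ i, 0 ≤ p.2 i) ∧ ∑ i, p.2 i ≤ t - p.1} with hS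
  have hSc : IsCompact S := by
    refine IsCompact.of_isClosed_subset (isCompact_Icc (a := 0) (b := (t, fun _ => t))) ?_ ?_
    · simp only [hS, Set.ofPred_and, Set.ofPred_forall]
      exact (isClosed_le (by fun_prop) (by fun_prop)).inter
        ((isClosed_iInter fun i => isClosed_le (by fun_prop) (by fun_prop)).inter
          (isClosed_le (by fun_prop) (by fun_prop)))
    · rintro ⟨u, s⟩ ⟨h, h0, h1⟩
      simp only at h h0 h1
      have hs := Finset.sum_nonneg fun i (_ : i ∈ Finset.univ) => h0 i
      refine ⟨⟨h, h0⟩, by simp only; linarith, fun i => ?_⟩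
      have := Finset.single_le_sum (fun j _ => h0 j) (Finset.mem_univ i)
      simp only
      linarith
  set G : ℝ × (Fin n → ℝ) → ℂ := S.indicator fun p => Complex.exp (-Complex.I *
        (E (Fin.last (n + 1)) * p.1 + pathPhase n (fun j => E j.castSucc) (t - p.1) p.2 : ℝ)) with hG
  have hGi : Integrable G := by
    rw [hG, integrable_indicator_iff hSc.measurableSet]
    refine ContinuousOn.integrableOn_compact hSc (Continuous.continuousOn ?_)
    unfold pathPhase
    fun_prop
  have hR : ∫ u in (0 : ℝ)..t, ∫ s in timeSimplex n (t - u), Complex.exp (-Complex.I *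
        (E (Fin.last (n + 1)) * u + pathPhase n (fun j => E j.castSucc) (t - u) s : ℝ)) =
      ∫ u, ∫ s, G (u, s) := by
    rw [intervalIntegral.integral_of_le ht, ← integral_Icc_eq_integral_Ioc,
      ← integral_indicator measurableSet_Icc]
    congr 1
    ext u
    by_cases hu : u ∈ Set.Icc 0 t
    · rw [Set.indicator_of_mem hu, ← integral_indicator (isCompact_timeSimplex _ _).measurableSet]
      congr 1
      ext s
      by_cases hs : s ∈ timeSimplex n (t - u)
      · rw [Set.indicator_of_mem hs, hG, Set.indicator_of_mem]
        exact ⟨hu.1, hs⟩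
      · rw [Set.indicator_of_notMem hs, hG, Set.indicator_of_notMem]
        exact fun h => hs h.2
    · rw [Set.indicator_of_notMem hu]
      symm
      refine integral_eq_zero_of_ae (Eventually.of_forall fun s => ?_)
      simp only [hG, Pi.zero_apply]
      refine Set.indicator_of_notMem (fun h => hu ⟨h.1, ?_⟩) _
      have := Finset.sum_nonneg fun i (_ : i ∈ Finset.univ) => h.2.1 i
      have := h.2.2
      simp only at *
      linarith
  set H : ℝ × (Fin n → ℝ) → ℂ := fun p => G (t - ∑ i, p.2 i - p.1, p.2) with hH
  have hHi : Integrable H := by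
    have h1 : H = ({p : ℝ × (Fin n → ℝ) | (t - ∑ i, p.2 i - p.1, p.2) ∈ S}).indicator fun p =>
        Complex.exp (-Complex.I * (E (Fin.last (n + 1)) * (t - ∑ i, p.2 i - p.1) +
          pathPhase n (fun j => E j.castSucc) (t - (t - ∑ i, p.2 i - p.1)) p.2 : ℝ)) := by
      ext p
      simp only [hH, hG, Set.indicator, Set.mem_ofPred_eq]
    have hc : IsCompact {p : ℝ × (Fin n → ℝ) | (t - ∑ i, p.2 i - p.1, p.2) ∈ S} := by
      refine IsCompact.of_isClosed_subset (isCompact_Icc (a := 0) (b := (t, fun _ => t)))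
        (hSc.isClosed.preimage (by fun_prop)) ?_
      rintro ⟨u, s⟩ ⟨h, h0, h1⟩
      simp only at h h0 h1
      have hs := Finset.sum_nonneg fun i (_ : i ∈ Finset.univ) => h0 i
      refine ⟨⟨by simp only [Prod.fst_zero]; linarith, h0⟩, by simp only; linarith, fun i => ?_⟩
      have := Finset.single_le_sum (fun j _ => h0 j) (Finset.mem_univ i)
      simp only
      linarith
    rw [h1, integrable_indicator_iff hc.measurableSet]
    refine ContinuousOn.integrableOn_compact hc (Continuous.continuousOn ?_)
    unfold pathPhase
    fun_prop
  have hL : ∫ s in timeSimplex (n + 1) t, Complex.exp (-Complex.I * pathPhase (n + 1) E t s) =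
      ∫ p, H p := by
    rw [← integral_indicator (isCompact_timeSimplex _ _).measurableSet,
      ← ((volume_preserving_piFinSuccAbove (fun _ : Fin (n + 1) => ℝ)
        (Fin.last n)).integral_comp' H)]
    congr 1
    ext s
    have hsum : ∑ i, s i = ∑ i : Fin n, s i.castSucc + s (Fin.last n) := Fin.sum_univ_castSucc _
    have h1 : (MeasurableEquiv.piFinSuccAbove (fun _ : Fin (n + 1) => ℝ) (Fin.last n)) s =
        (s (Fin.last n), fun i => s i.castSucc) := by
      ext
      · rfl
      · simp [MeasurableEquiv.piFinSuccAbove, Fin.insertNthEquiv, Fin.init]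
    rw [h1]
    simp only [hH, hG]
    by_cases hs : s ∈ timeSimplex (n + 1) t
    · rw [Set.indicator_of_mem hs, Set.indicator_of_mem]
      · congr 2
        norm_cast
        simp only [pathPhase, Fin.sum_univ_castSucc]
        ring_nf
      · refine ⟨?_, fun i => hs.1 _, ?_⟩
        · have := hs.2
          simp only
          linarith
        · have := hs.1 (Fin.last n)
          simp only
          linarith
    · rw [Set.indicator_of_notMem hs, Set.indicator_of_notMem]
      rintro ⟨h, h0, h1⟩
      refine hs ⟨fun i => ?_, by simp only at h; linarith⟩
      refine Fin.lastCases ?_ (fun i => h0 i) i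
      simp only at h1
      linarith
  rw [hR, hL, Measure.volume_eq_prod, integral_prod_symm _ (by simpa [← Measure.volume_eq_prod]),
    integral_integral_swap (f := fun u s => G (u, s)) hGi]
  congr 1
  ext s
  simp only [hH]
  exact integral_sub_left_eq_self (fun u => G (u, s)) volume (t - ∑ i, s i)

lemma propagator_eq_integral (n : ℕ) (E : Fin (n + 1) → ℝ) {t : ℝ} (ht : 0 ≤ t) :
    propagator n E t = (-Complex.I) ^ n *
      ∫ s in timeSimplex n t, Complex.exp (-Complex.I * pathPhase n E t s) := by
  induction n generalizing t with
  | zero =>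
    have h : timeSimplex 0 t = Set.univ := by
      ext s
      simp [timeSimplex, ht]
    rw [h, Measure.restrict_univ, Measure.volume_pi_eq_dirac, integral_dirac]
    simp [propagator, pathPhase, mul_assoc]
  | succ n ih =>
    rw [integral_timeSimplex_succ n E ht, propagator, pow_succ', mul_assoc]
    congr 1
    rw [← intervalIntegral.integral_const_mul]
    refine intervalIntegral.integral_congr fun u hu => ?_
    rw [Set.uIcc_of_le ht] at hu
    rw [ih _ (by linarith [hu.2]), mul_left_comm, ← integral_const_mul]
    congr 2
    ext s
    rw [← Complex.exp_add]
    congr 1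
    push_cast
    ring

/-! ### The amplitude as an oscillatory integral over the free times -/

/-- The positions of a history that carry a free time. -/
def freePos (n m : ℕ) : Fin n ⊕ Fin m → Fin (m + n + 1) :=
  Sum.elim (fun j => ketPos n m j.castSucc) (fun j => braPos n m j.castSucc)

/-- The sign with which a free time enters the phase. -/
def freeSign (n m : ℕ) : Fin n ⊕ Fin m → ℝ := Sum.elim (fun _ => 1) (fun _ => -1)

/-- The domain of the free times of ket and bra. -/
def timeDomain (n m : ℕ) (t : ℝ) : Set (Fin n ⊕ Fin m → ℝ) :=
  {s | (fun i => s (Sum.inl i)) ∈ timeSimplex n t ∧ (fun i => s (Sum.inr i)) ∈ timeSimplex m t}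

lemma timeDomain_subset_Icc (n m : ℕ) (t : ℝ) : timeDomain n m t ⊆ Set.Icc 0 (fun _ => t) := by
  rintro s ⟨⟨h0, h1⟩, ⟨h2, h3⟩⟩
  refine ⟨?_, ?_⟩
  · rintro (i | i)
    exacts [h0 i, h2 i]
  · rintro (i | i)
    · exact (Finset.single_le_sum (fun j _ => h0 j) (Finset.mem_univ i)).trans h1
    · exact (Finset.single_le_sum (fun j _ => h2 j) (Finset.mem_univ i)).trans h3

lemma isCompact_timeDomain (n m : ℕ) (t : ℝ) : IsCompact (timeDomain n m t) :=
  isCompact_Icc.of_isClosed_subset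
    (((isCompact_timeSimplex n t).isClosed.preimage (by fun_prop)).inter
      ((isCompact_timeSimplex m t).isClosed.preimage (by fun_prop)))
    (timeDomain_subset_Icc n m t)

instance isFiniteMeasure_restrict_timeDomain (n m : ℕ) (t : ℝ) :
    IsFiniteMeasure ((volume : Measure (Fin n ⊕ Fin m → ℝ)).restrict (timeDomain n m t)) :=
  ⟨by simpa using (isCompact_timeDomain n m t).measure_lt_top⟩

/-- The constant in front of the amplitude. -/
noncomputable def amplitudePrefactor (n m : ℕ) : ℂ := (-Complex.I) ^ n * Complex.I ^ m

lemma norm_amplitudePrefactor (n m : ℕ) : ‖amplitudePrefactor n m‖ = 1 := by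
  simp [amplitudePrefactor]

lemma amplitude_eq_integral {n m : ℕ} {t : ℝ} (ht : 0 ≤ t) (e : Fin (m + n + 1) → ℝ)
    (he : e 0 = e (Fin.last _)) :
    amplitude n m t e = amplitudePrefactor n m * ∫ s in timeDomain n m t,
      Complex.exp (-Complex.I *
        (∑ j, freeSign n m j * (e (freePos n m j) - e (Fin.last _)) * s j : ℝ)) := by
  have hstar : star (propagator m (fun j => e (braPos n m j)) t) = Complex.I ^ m *
      ∫ s in timeSimplex m t, Complex.exp (Complex.I *
        pathPhase m (fun j => e (braPos n m j)) t s) := by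
    rw [propagator_eq_integral _ _ ht]
    simp only [Complex.star_def, map_mul, map_pow, map_neg, Complex.conj_I, neg_neg]
    rw [← integral_conj]
    congr 2
    ext s
    rw [← Complex.exp_conj]
    simp
  rw [amplitude, propagator_eq_integral _ _ ht, hstar, mul_mul_mul_comm, amplitudePrefactor,
    ← integral_prod_mul, Measure.prod_restrict, ← Measure.volume_eq_prod]
  congr 1
  rw [← (volume_measurePreserving_sumPiEquivProdPi
    (fun _ : Fin n ⊕ Fin m => ℝ)).setIntegral_preimage_emb (MeasurableEquiv.measurableEmbedding _)]
  have hset : (MeasurableEquiv.sumPiEquivProdPi fun _ : Fin n ⊕ Fin m => ℝ) ⁻¹'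
      (timeSimplex n t ×ˢ timeSimplex m t) = timeDomain n m t := by
    ext s
    rfl
  rw [hset]
  congr 1
  ext s
  rw [← Complex.exp_add]
  congr 1
  have h0 : braPos n m (Fin.last m) = 0 := by ext; simp [braPos]
  have h1 : ketPos n m (Fin.last n) = Fin.last _ := by ext; simp [ketPos]
  have key : ∑ j, freeSign n m j * (e (freePos n m j) - e (Fin.last _)) * s j =
      pathPhase n (fun j => e (ketPos n m j)) t (fun i => s (Sum.inl i)) -
      pathPhase m (fun j => e (braPos n m j)) t (fun i => s (Sum.inr i)) := by
    simp only [pathPhase, Fintype.sum_sum_type, freeSign, freePos, Sum.elim_inl, Sum.elim_inr,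
      h0, h1, he, mul_sub, sub_mul, Finset.sum_sub_distrib, Finset.mul_sum, one_mul, neg_mul,
      Finset.sum_neg_distrib]
    ring
  rw [key]
  change -Complex.I * (pathPhase n _ t (fun i => s (Sum.inl i)) : ℂ) +
    Complex.I * (pathPhase m _ t (fun i => s (Sum.inr i)) : ℂ) = _
  push_cast
  ring

section Classes

variable {J V : Type*} [Fintype J]

open Classical in
/-- The signed total time spent in the energy class `v`. -/
noncomputable def classTime (sgn : J → ℝ) (cls : J → V) (v : V) (s : J → ℝ) : ℝ :=
  ∑ j with cls j = v, sgn j * s j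

@[fun_prop]
lemma continuous_classTime (sgn : J → ℝ) (cls : J → V) (v : V) :
    Continuous (classTime sgn cls v) := by
  unfold classTime
  fun_prop

variable [Fintype V]

open Classical in
/-- The time conjugate to the energy of the class `v`, the last times of bra and ket belonging to
the class `r`. -/
noncomputable def phaseTime (sgn : J → ℝ) (cls : J → V) (r v : V) (s : J → ℝ) : ℝ :=
  if v = r then -∑ u with u ≠ r, classTime sgn cls u s else classTime sgn cls v s

@[fun_prop]
lemma continuous_phaseTime (sgn : J → ℝ) (cls : J → V) (r v : V) :
    Continuous (phaseTime sgn cls r v) := by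
  unfold phaseTime
  split_ifs <;> fun_prop

lemma sum_mul_phaseTime (sgn : J → ℝ) (cls : J → V) (r : V) (ω : V → ℝ) (s : J → ℝ) :
    ∑ v, ω v * phaseTime sgn cls r v s = ∑ j, sgn j * (ω (cls j) - ω r) * s j := by
  classical
  have h1 : ∀ v, ω v * phaseTime sgn cls r v s =
      (if v ≠ r then ω v * classTime sgn cls v s else 0) +
      (if v = r then -ω r * ∑ u with u ≠ r, classTime sgn cls u s else 0) := by
    intro v
    by_cases hv : v = r <;> simp [phaseTime, hv]
  have h2 : ∑ j, sgn j * (ω (cls j) - ω r) * s j =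
      ∑ v, (ω v - ω r) * classTime sgn cls v s := by
    rw [← Finset.sum_fiberwise (s := Finset.univ) (g := cls)]
    refine Finset.sum_congr rfl fun v _ => ?_
    rw [classTime, Finset.mul_sum]
    refine Finset.sum_congr (by ext; simp) fun j hj => ?_
    rw [(Finset.mem_filter.1 hj).2]
    ring
  simp only [h1]
  rw [Finset.sum_add_distrib, h2, Finset.sum_ite_eq' Finset.univ r, ← Finset.sum_filter,
    ← Finset.sum_filter_add_sum_filter_not Finset.univ (fun v => v ≠ r)
      (fun v => (ω v - ω r) * classTime sgn cls v s)]
  simp only [Finset.mem_univ, if_true, ne_eq, not_not]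
  rw [Finset.sum_filter (fun v => v = r), Finset.sum_ite_eq' Finset.univ r]
  simp only [Finset.mem_univ, if_true, sub_self, zero_mul, add_zero, sub_mul,
    Finset.sum_sub_distrib, Finset.mul_sum, neg_mul, Finset.sum_neg_distrib]
  ring

end Classes

/-- The energy class of a free time. -/
def freeClass {n m : ℕ} (π : Pairing (m + n)) (j : Fin n ⊕ Fin m) : EnergyVar π :=
  EnergyVar.mk π (freePos n m j)

/-- The energy class of the last energy. -/
def rootClass {n m : ℕ} (π : Pairing (m + n)) : EnergyVar π :=
  EnergyVar.mk π (ketPos n m (Fin.last n))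

lemma rootClass_eq_last {n m : ℕ} (π : Pairing (m + n)) :
    rootClass π = EnergyVar.mk π (Fin.last _) := by
  have h1 : ketPos n m (Fin.last n) = Fin.last _ := by ext; simp [ketPos]
  rw [rootClass, h1]

/-- The time conjugate to an independent energy of a graph. -/
noncomputable def graphTime {n m : ℕ} (π : Pairing (m + n)) (v : EnergyVar π)
    (s : Fin n ⊕ Fin m → ℝ) : ℝ :=
  phaseTime (freeSign n m) (freeClass π) (rootClass π) v s

@[fun_prop]
lemma continuous_graphTime {n m : ℕ} (π : Pairing (m + n)) (v : EnergyVar π) :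
    Continuous (graphTime π v) := continuous_phaseTime _ _ _ _

lemma amplitude_comp_mk {n m : ℕ} (π : Pairing (m + n)) {t : ℝ} (ht : 0 ≤ t)
    (h0 : EnergyVar.mk π 0 = EnergyVar.mk π (Fin.last _)) (ω : EnergyVar π → ℝ) :
    amplitude n m t (fun i => ω (EnergyVar.mk π i)) =
      amplitudePrefactor n m * ∫ s in timeDomain n m t,
        ∏ v, Complex.exp (-Complex.I * (ω v * graphTime π v s : ℝ)) := by
  rw [amplitude_eq_integral ht _ (by rw [h0])]
  congr 2
  ext s
  rw [← Complex.exp_sum, ← Finset.mul_sum]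
  congr 2
  rw [← Complex.ofReal_sum]
  congr 1
  simp only [graphTime]
  rw [sum_mul_phaseTime, rootClass_eq_last]
  rfl

lemma integral_amplitude {n m : ℕ} (π : Pairing (m + n)) {t : ℝ} (ht : 0 ≤ t)
    (h0 : EnergyVar.mk π 0 = EnergyVar.mk π (Fin.last _)) (μ : EnergyVar π → Measure ℝ)
    [∀ v, IsFiniteMeasure (μ v)] :
    ∫ ω, amplitude n m t (fun i => ω (EnergyVar.mk π i)) ∂(Measure.pi μ) =
      amplitudePrefactor n m * ∫ s in timeDomain n m t,
        ∏ v, ∫ e, Complex.exp (-Complex.I * (e * graphTime π v s : ℝ)) ∂(μ v) := by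
  simp only [amplitude_comp_mk π ht h0]
  rw [integral_const_mul, integral_integral_swap]
  · congr 2
    ext s
    exact integral_fintype_prod_eq_prod
      (fun v (e : ℝ) => Complex.exp (-Complex.I * (e * graphTime π v s : ℝ)))
  · refine Integrable.of_bound (C := 1) (Continuous.aestronglyMeasurable ?_)
      (Eventually.of_forall fun p => ?_)
    · simp only [Function.uncurry_def]
      fun_prop
    · simp only [Function.uncurry_def, norm_prod]
      refine Finset.prod_le_one (fun _ _ => norm_nonneg _) fun v _ => ?_
      rw [Complex.norm_exp]
      simp

/-! ### Covariances of the interaction -/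

lemma measurable_ofReal_add_ofReal_mul_I :
    Measurable fun p : ℝ × ℝ => (p.1 : ℂ) + (p.2 : ℂ) * Complex.I := by fun_prop

instance isProbabilityMeasure_complexGaussian (v : ℝ≥0) :
    IsProbabilityMeasure (complexGaussian v) :=
  Measure.isProbabilityMeasure_map measurable_ofReal_add_ofReal_mul_I.aemeasurable

instance isProbabilityMeasure_blockLaw (N : ℕ) : IsProbabilityMeasure (blockLaw N) := by
  unfold blockLaw
  infer_instance

lemma measurePreserving_I_mul_complexGaussian (v : ℝ≥0) :
    MeasurePreserving (fun z : ℂ => Complex.I * z) (complexGaussian v) (complexGaussian v) := by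
  refine ⟨by fun_prop, ?_⟩
  have hneg : MeasurePreserving (fun x : ℝ => -x) (gaussianReal 0 (v / 2))
      (gaussianReal 0 (v / 2)) := ⟨by fun_prop, by rw [gaussianReal_map_neg, neg_zero]⟩
  have h := (hneg.prod (MeasurePreserving.id (gaussianReal 0 (v / 2)))).comp
    (Measure.measurePreserving_swap (μ := gaussianReal 0 (v / 2)) (ν := gaussianReal 0 (v / 2)))
  conv_rhs => rw [complexGaussian, ← h.map_eq]
  rw [complexGaussian, Measure.map_map (by fun_prop) (by fun_prop),
    Measure.map_map (by fun_prop) h.measurable]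
  congr 1
  ext p
  simp only [Function.comp_apply, Prod.swap, Prod.map, id, Complex.ofReal_neg]
  linear_combination (p.2 : ℂ) * Complex.I_mul_I

lemma integral_sq_gaussianReal (v : ℝ≥0) : ∫ x, x ^ 2 ∂(gaussianReal 0 v) = v := by
  have h := variance_fun_id_gaussianReal (μ := 0) (v := v)
  rwa [variance_of_integral_eq_zero (by fun_prop) (by simp)] at h

lemma integrable_sq_gaussianReal (v : ℝ≥0) : Integrable (fun x => x ^ 2) (gaussianReal 0 v) :=
  (memLp_id_gaussianReal 2).integrable_sq

lemma integral_mul_star_complexGaussian (v : ℝ≥0) :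
    ∫ z, z * star z ∂(complexGaussian v) = v := by
  rw [complexGaussian, integral_map (by fun_prop) (by fun_prop)]
  have h : ∀ p : ℝ × ℝ, ((p.1 : ℂ) + p.2 * Complex.I) * star ((p.1 : ℂ) + p.2 * Complex.I) =
      ((p.1 ^ 2 + p.2 ^ 2 : ℝ) : ℂ) := by
    intro p
    simp only [Complex.star_def, Complex.mul_conj, Complex.normSq_add_mul_I]
  simp only [h]
  rw [integral_complex_ofReal, integral_add,
    integral_fun_fst (fun x : ℝ => x ^ 2), integral_fun_snd (fun x : ℝ => x ^ 2)]
  · simp only [probReal_univ, one_smul, integral_sq_gaussianReal, NNReal.coe_div]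
    norm_num
  · exact (integrable_sq_gaussianReal _).comp_fst _
  · exact (integrable_sq_gaussianReal _).comp_snd _

/-- A symmetry of the law of the block: one entry is multiplied by `I`. -/
lemma measurePreserving_rotate_blockLaw {N : ℕ} (a b : Fin N) :
    MeasurePreserving (fun (z : Fin N → Fin N → ℂ) c d =>
      if c = a ∧ d = b then Complex.I * z c d else z c d) (blockLaw N) (blockLaw N) := by
  refine measurePreserving_pi (fun _ => Measure.pi fun _ => complexGaussian (1 / (N : ℝ≥0)))
    (fun _ => Measure.pi fun _ => complexGaussian (1 / (N : ℝ≥0)))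
    (f := fun c (w : Fin N → ℂ) d => if c = a ∧ d = b then Complex.I * w d else w d) fun c => ?_
  refine measurePreserving_pi (fun _ => complexGaussian (1 / (N : ℝ≥0)))
    (fun _ => complexGaussian (1 / (N : ℝ≥0))) (f := fun d (w : ℂ) =>
    if c = a ∧ d = b then Complex.I * w else w) fun d => ?_
  by_cases h : c = a ∧ d = b
  · simpa only [h, and_self, if_true] using measurePreserving_I_mul_complexGaussian _
  · simp only [h, if_false]
    exact MeasurePreserving.id _

lemma integral_rotate_blockLaw {N : ℕ} (a b : Fin N) {f : (Fin N → Fin N → ℂ) → ℂ}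
    (hf : Measurable f) :
    ∫ z, f (fun c d => if c = a ∧ d = b then Complex.I * z c d else z c d) ∂(blockLaw N) =
      ∫ z, f z ∂(blockLaw N) := by
  have h := measurePreserving_rotate_blockLaw a b
  conv_rhs => rw [← h.map_eq, integral_map h.measurable.aemeasurable hf.aestronglyMeasurable]

lemma integral_eq_zero_of_rotate {N : ℕ} (a b : Fin N) {f : (Fin N → Fin N → ℂ) → ℂ}
    (hf : Measurable f) (c : ℂ) (hc : c ≠ 1)
    (h : ∀ z, f (fun c d => if c = a ∧ d = b then Complex.I * z c d else z c d) = c * f z) :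
    ∫ z, f z ∂(blockLaw N) = 0 := by
  have h1 := integral_rotate_blockLaw a b hf
  simp only [h] at h1
  rw [integral_const_mul] at h1
  have h2 : (c - 1) * ∫ z, f z ∂(blockLaw N) = 0 := by rw [sub_mul, one_mul, h1, sub_self]
  exact (mul_eq_zero.1 h2).resolve_left (sub_ne_zero.2 hc)

lemma I_ne_one : Complex.I ≠ 1 := fun h => by simpa using congrArg Complex.im h

lemma integral_blockLaw_mul {N : ℕ} (a b c d : Fin N) :
    ∫ z, z a b * z c d ∂(blockLaw N) = 0 := by
  by_cases h : c = a ∧ d = b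
  · refine integral_eq_zero_of_rotate a b (by fun_prop) (-1) (by norm_num) fun z => ?_
    simp only [h, and_self, if_true]
    linear_combination z a b * z a b * Complex.I_mul_I
  · refine integral_eq_zero_of_rotate a b (by fun_prop) Complex.I I_ne_one fun z => ?_
    simp only [h, and_self, if_true, if_false]
    ring

lemma integral_blockLaw_star_mul_star {N : ℕ} (a b c d : Fin N) :
    ∫ z, star (z a b) * star (z c d) ∂(blockLaw N) = 0 := by
  have h := congrArg star (integral_blockLaw_mul a b c d)
  rw [Complex.star_def, ← integral_conj] at h
  simpa using h

lemma integral_blockLaw_mul_star {N : ℕ} (a b c d : Fin N) :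
    ∫ z, z a b * star (z c d) ∂(blockLaw N) = if c = a ∧ d = b then 1 / (N : ℂ) else 0 := by
  split_ifs with h
  · obtain ⟨rfl, rfl⟩ := h
    have h1 : MeasurePreserving (fun z : Fin N → Fin N → ℂ => z c d) (blockLaw N)
        (complexGaussian (1 / (N : ℝ≥0))) :=
      (measurePreserving_eval (fun _ : Fin N => complexGaussian (1 / (N : ℝ≥0))) d).comp
        (measurePreserving_eval
          (fun _ : Fin N => Measure.pi fun _ : Fin N => complexGaussian (1 / (N : ℝ≥0))) c)
    have h2 := integral_mul_star_complexGaussian (1 / (N : ℝ≥0))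
    rw [← h1.map_eq, integral_map h1.measurable.aemeasurable (by fun_prop)] at h2
    rw [h2]
    simp
  · refine integral_eq_zero_of_rotate a b (by fun_prop) Complex.I I_ne_one fun z => ?_
    simp only [h, and_self, if_true, if_false]
    ring

lemma integral_blockLaw_star_mul {N : ℕ} (a b c d : Fin N) :
    ∫ z, star (z a b) * z c d ∂(blockLaw N) = if c = a ∧ d = b then 1 / (N : ℂ) else 0 := by
  simp only [mul_comm (star _)]
  rw [integral_blockLaw_mul_star]
  simp only [eq_comm]

lemma contraction_eq {N : ℕ} (i j k l : Fin 2 × Fin N) :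
    contraction i j k l = if i.1 ≠ j.1 ∧ k = j ∧ l = i then 1 / (N : ℂ) else 0 := by
  obtain ⟨x, a⟩ := i
  obtain ⟨y, b⟩ := j
  obtain ⟨u, c⟩ := k
  obtain ⟨v, d⟩ := l
  unfold contraction interaction
  fin_cases x <;> fin_cases y <;> fin_cases u <;> fin_cases v <;>
    simp [-Complex.star_def, -RCLike.star_def, integral_blockLaw_mul,
      integral_blockLaw_star_mul_star, integral_blockLaw_mul_star,
      integral_blockLaw_star_mul, and_comm]

/-! ### Combinatorics of pairings without crossings -/

section Pairings

variable {k : ℕ} (π : Pairing k)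

lemma Pairing.apply_apply (i : Fin k) : π.1 (π.1 i) = i := (π.2 i).2

lemma Pairing.apply_ne (i : Fin k) : π.1 i ≠ i := (π.2 i).1

lemma EnergyVar.mk_castSucc (i : Fin k) :
    EnergyVar.mk π i.castSucc = EnergyVar.mk π (π.1 i).succ :=
  Quot.sound ⟨i, rfl, rfl⟩

lemma EnergyVar.mk_succ (i : Fin k) :
    EnergyVar.mk π i.succ = EnergyVar.mk π (π.1 i).castSucc := by
  rw [EnergyVar.mk_castSucc, Pairing.apply_apply]

lemma EnergyVar.exists_mk (v : EnergyVar π) : ∃ i, EnergyVar.mk π i = v :=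
  Quot.exists_rep v

/-- A set of positions compatible with the identifications is a union of energy classes. -/
lemma EnergyVar.mem_iff_of_mk_eq {P : Fin (k + 1) → Prop}
    (hP : ∀ i : Fin k, P i.castSucc ↔ P (π.1 i).succ) {a b : Fin (k + 1)}
    (hab : EnergyVar.mk π a = EnergyVar.mk π b) : P a ↔ P b := by
  let f : EnergyVar π → Prop := Quot.lift P (by
    rintro a b ⟨i, rfl, rfl⟩
    exact propext (hP i))
  have h : f (EnergyVar.mk π a) = f (EnergyVar.mk π b) := by rw [hab]
  exact iff_of_eq h

lemma EnergyVar.mk_zero_eq_mk_last : EnergyVar.mk π 0 = EnergyVar.mk π (Fin.last k) := by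
  classical
  by_contra hne
  let S : Finset (Fin (k + 1)) := {a | EnergyVar.mk π a = EnergyVar.mk π 0}
  let S' : Finset (Fin k) := {i | i.castSucc ∈ S}
  have h1 : S'.image Fin.castSucc = S := by
    ext a
    simp only [S', Finset.mem_image, Finset.mem_filter, Finset.mem_univ, true_and]
    refine ⟨?_, fun ha => ?_⟩
    · rintro ⟨i, hi, rfl⟩
      exact hi
    · rcases Fin.eq_castSucc_or_eq_last a with ⟨i, rfl⟩ | rfl
      · exact ⟨i, ha, rfl⟩
      · exact absurd (Finset.mem_filter.1 ha).2.symm hne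
  have h2 : S'.image (fun i => (π.1 i).succ) ⊆ S.erase 0 := by
    intro a ha
    obtain ⟨i, hi, rfl⟩ := Finset.mem_image.1 ha
    have h3 := (Finset.mem_filter.1 (Finset.mem_filter.1 hi).2).2
    refine Finset.mem_erase.2 ⟨Fin.succ_ne_zero _, Finset.mem_filter.2 ⟨Finset.mem_univ _, ?_⟩⟩
    rw [← EnergyVar.mk_castSucc, h3]
  have h3 := Finset.card_le_card h2
  have h0 : (0 : Fin (k + 1)) ∈ S := by simp [S]
  rw [Finset.card_image_of_injective (f := fun i => (π.1 i).succ) _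
      fun a b h => π.1.injective (Fin.succ_injective _ h),
    Finset.card_erase_of_mem h0, ← h1,
    Finset.card_image_of_injective _ (Fin.castSucc_injective _)] at h3
  have h4 : 0 < S'.card := by
    rw [← Finset.card_image_of_injective S' (Fin.castSucc_injective _), h1]
    exact Finset.card_pos.2 ⟨0, h0⟩
  omega

open Classical in
/-- The left endpoints of the pairs. -/
noncomputable def Pairing.openings : Finset (Fin k) := {i | i < π.1 i}

lemma Pairing.mem_openings {i : Fin k} : i ∈ π.openings ↔ i < π.1 i := by
  simp [Pairing.openings]

lemma Pairing.two_mul_card_openings : 2 * π.openings.card = k := by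
  classical
  have h1 : (Finset.univ.filter fun i => ¬ i < π.1 i).card = π.openings.card := by
    refine (Finset.card_bij (fun i _ => π.1 i) (fun i hi => ?_)
      (fun a _ b _ h => π.1.injective h) fun j hj => ⟨π.1 j, ?_, π.apply_apply j⟩).symm
    · rw [Pairing.mem_openings] at hi
      simpa [π.apply_apply] using hi.le
    · rw [Pairing.mem_openings, π.apply_apply]
      exact lt_of_le_of_ne (by simpa using hj) (π.apply_ne j)
  have h2 := Finset.card_filter_add_card_filter_not (s := (Finset.univ : Finset (Fin k)))
    (fun i => i < π.1 i)
  rw [h1, Finset.card_univ, Fintype.card_fin] at h2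
  have h3 : (Finset.univ.filter fun i => i < π.1 i).card = π.openings.card := by
    unfold Pairing.openings
    congr
  omega

variable {π}

lemma Pairing.apply_mem_Ioo (hπ : ¬ HasCrossing π) {i a : Fin k} (h1 : i < a) (h2 : a < π.1 i) :
    i < π.1 a ∧ π.1 a < π.1 i := by
  have hne1 : π.1 a ≠ i := fun h => by
    rw [← h, π.apply_apply] at h2
    exact lt_irrefl _ h2
  have hne2 : π.1 a ≠ π.1 i := fun h => h1.ne' (π.1.injective h)
  constructor
  · by_contra hcon
    have h3 : π.1 a < i := lt_of_le_of_ne (not_lt.1 hcon) hne1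
    exact hπ ⟨π.1 a, i, h3, by rwa [π.apply_apply], by rwa [π.apply_apply]⟩
  · by_contra hcon
    exact hπ ⟨i, a, h1, h2, lt_of_le_of_ne (not_lt.1 hcon) hne2.symm⟩

/-- The energy class opened by a pair lies between its endpoints. -/
lemma EnergyVar.mem_Ioc_of_mk_eq (hπ : ¬ HasCrossing π) {i : Fin k} (hi : i < π.1 i)
    {a : Fin (k + 1)} (ha : EnergyVar.mk π a = EnergyVar.mk π i.succ) :
    (i : ℕ) < a ∧ (a : ℕ) ≤ π.1 i := by
  have key := EnergyVar.mem_iff_of_mk_eq π (P := fun a => (i : ℕ) < a ∧ (a : ℕ) ≤ π.1 i) ?_ ha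
  · refine key.2 ⟨by simp, ?_⟩
    rw [Fin.lt_def] at hi
    simpa using hi
  intro l
  simp only [Fin.val_castSucc, Fin.val_succ]
  constructor
  · rintro ⟨h1, h2⟩
    rcases h2.lt_or_eq with h2 | h2
    · have := Pairing.apply_mem_Ioo hπ (Fin.lt_def.2 h1) (Fin.lt_def.2 h2)
      simp only [Fin.lt_def] at this
      omega
    · have hl : l = π.1 i := Fin.ext h2
      rw [hl, π.apply_apply]
      omega
  · rintro ⟨h1, h2⟩
    rcases (Nat.lt_succ_iff.1 h1).lt_or_eq with h1 | h1
    · have := Pairing.apply_mem_Ioo hπ (Fin.lt_def.2 h1) (Fin.lt_def.2 h2)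
      rw [π.apply_apply] at this
      simp only [Fin.lt_def] at this
      omega
    · have hl : π.1 l = i := Fin.ext h1.symm
      have hl' : l = π.1 i := by rw [← hl, π.apply_apply]
      rw [hl']
      rw [Fin.lt_def] at hi
      omega

lemma EnergyVar.mk_succ_ne_mk_last (hπ : ¬ HasCrossing π) {i : Fin k} (hi : i < π.1 i) :
    EnergyVar.mk π i.succ ≠ EnergyVar.mk π (Fin.last k) := fun h => by
  have := EnergyVar.mem_Ioc_of_mk_eq hπ hi h.symm
  simp only [Fin.val_last] at this
  omega

open Classical in
lemma EnergyVar.card_ne_mk_last (hπ : ¬ HasCrossing π) :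
    (Finset.univ.filter fun v : EnergyVar π => v ≠ EnergyVar.mk π (Fin.last k)).card =
      π.openings.card := by
  refine (Finset.card_bij (fun i _ => EnergyVar.mk π i.succ) (fun i hi => ?_)
    (fun i hi j hj h => ?_) fun v hv => ?_).symm
  · rw [Pairing.mem_openings] at hi
    simpa using EnergyVar.mk_succ_ne_mk_last hπ hi
  · rw [Pairing.mem_openings] at hi hj
    have h1 := EnergyVar.mem_Ioc_of_mk_eq hπ hi h.symm
    have h2 := EnergyVar.mem_Ioc_of_mk_eq hπ hj h
    simp only [Fin.val_succ] at h1 h2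
    exact Fin.ext (by omega)
  · obtain ⟨a, ha⟩ : ∃ a, EnergyVar.mk π a = v ∧ ∀ b, EnergyVar.mk π b = v → a ≤ b := by
      obtain ⟨b, hb⟩ := EnergyVar.exists_mk π v
      obtain ⟨a, ha, hmin⟩ := (Finset.univ.filter fun a => EnergyVar.mk π a = v).exists_min_image id
        ⟨b, by simpa using hb⟩
      exact ⟨a, by simpa using ha, fun b hb => hmin b (by simpa using hb)⟩
    obtain ⟨rfl, hmin⟩ := ha
    have ha0 : a ≠ 0 := by
      rintro rfl
      simp [EnergyVar.mk_zero_eq_mk_last] at hv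
    obtain ⟨i, rfl⟩ := Fin.exists_succ_eq.2 ha0
    refine ⟨i, ?_, rfl⟩
    rw [Pairing.mem_openings]
    have h := hmin _ (EnergyVar.mk_succ π i).symm
    rw [Fin.le_def, Fin.val_succ, Fin.val_castSucc] at h
    rw [Fin.lt_def]
    omega

/-- The endpoints of a pair have different parities. -/
lemma Pairing.odd_add_apply (hπ : ¬ HasCrossing π) (i : Fin k) : Odd ((i : ℕ) + π.1 i) := by
  have main : ∀ i, i < π.1 i → Odd ((i : ℕ) + π.1 i) := by
    intro i hi
    have h : ∑ _a ∈ Finset.Ioo i (π.1 i), (1 : ZMod 2) = 0 := by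
      refine Finset.sum_involution (fun a _ => π.1 a) (fun _ _ => by decide)
        (fun a _ _ => π.apply_ne a) (fun a ha => ?_) fun a _ => π.apply_apply a
      rw [Finset.mem_Ioo] at ha ⊢
      exact Pairing.apply_mem_Ioo hπ ha.1 ha.2
    rw [Finset.sum_const, Fin.card_Ioo, nsmul_eq_mul, mul_one, ZMod.natCast_eq_zero_iff_even] at h
    rw [Fin.lt_def] at hi
    rw [Nat.odd_iff]
    rw [Nat.even_iff] at h
    omega
  rcases lt_or_gt_of_ne (π.apply_ne i) with h | h
  · have := main (π.1 i) (by rwa [π.apply_apply])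
    rwa [π.apply_apply, add_comm] at this
  · exact main i h

end Pairings

/-! ### The graph function and the sum over histories -/

/-- The histories compatible with the contractions of a graph. -/
def IsCompatible {N k : ℕ} (π : Pairing k) (h : Fin (k + 1) → Fin 2 × Fin N) : Prop :=
  ∀ l : Fin k, (h l.castSucc).1 ≠ (h l.succ).1 ∧ h (π.1 l).castSucc = h l.succ

open Classical in
lemma graphFunction_eq {N k : ℕ} (π : Pairing k) (h : Fin (k + 1) → Fin 2 × Fin N) :
    graphFunction π h = if IsCompatible π h then (1 / (N : ℂ)) ^ π.openings.card else 0 := by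
  unfold graphFunction
  simp only [contraction_eq]
  split_ifs with hc
  · rw [Finset.prod_congr rfl (g := fun _ => 1 / (N : ℂ)), Finset.prod_const]
    · congr 2
    · intro l _
      rw [if_pos]
      refine ⟨(hc l).1, (hc l).2, ?_⟩
      have := (hc (π.1 l)).2
      rw [π.apply_apply] at this
      exact this.symm
  · rw [IsCompatible, not_forall] at hc
    obtain ⟨l, hl⟩ := hc
    rcases lt_or_gt_of_ne (π.apply_ne l) with h1 | h1
    · refine Finset.prod_eq_zero (i := π.1 l) (by simpa [π.apply_apply] using h1) (if_neg ?_)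
      rw [π.apply_apply]
      rintro ⟨h2, h3, h4⟩
      exact hl ⟨by rw [h3, h4]; exact h2.symm, h4.symm⟩
    · refine Finset.prod_eq_zero (i := l) (by simpa using h1) (if_neg ?_)
      rintro ⟨h2, h3, h4⟩
      exact hl ⟨h2, h3⟩

/-- The site at a position of a history whose site at the position `m` is `x`. -/
def siteAt (m : ℕ) (x : Fin 2) (i : ℕ) : Fin 2 := if Even (m + i) then x else x + 1

/-- The history with prescribed independent energies. -/
def historyOf {N n m : ℕ} (π : Pairing (m + n)) (x : Fin 2) (ω : EnergyVar π → Fin N)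
    (i : Fin (m + n + 1)) : Fin 2 × Fin N := (siteAt m x i, ω (EnergyVar.mk π i))

lemma siteAt_succ_ne (m : ℕ) (x : Fin 2) (i : ℕ) : siteAt m x i ≠ siteAt m x (i + 1) := by
  unfold siteAt
  simp only [← add_assoc, Nat.even_add_one]
  by_cases hi : Even (m + i)
  · simp [hi]
  · simp [hi]

lemma isCompatible_historyOf {N n m : ℕ} {π : Pairing (m + n)} (hπ : ¬ HasCrossing π) (x : Fin 2)
    (ω : EnergyVar π → Fin N) : IsCompatible π (historyOf π x ω) := by
  intro l
  refine ⟨siteAt_succ_ne m x l, Prod.ext ?_ ?_⟩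
  · have := Pairing.odd_add_apply hπ l
    simp only [historyOf, siteAt, Fin.val_castSucc, Fin.val_succ]
    congr 1
    rw [Nat.odd_iff] at this
    simp only [Nat.even_iff, eq_iff_iff]
    omega
  · simp only [historyOf]
    rw [EnergyVar.mk_succ]

lemma exists_eq_historyOf {N n m : ℕ} {π : Pairing (m + n)} {x : Fin 2}
    {h : Fin (m + n + 1) → Fin 2 × Fin N} (hc : IsCompatible π h)
    (hx : (h (ketPos n m 0)).1 = x) : ∃ ω, historyOf π x ω = h := by
  have hstep : ∀ y z : Fin 2, y ≠ z → z = y + 1 := by decide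
  have hsite : ∀ (i : ℕ) (hi : i < m + n + 1),
      (h ⟨i, hi⟩).1 = if Even i then (h 0).1 else (h 0).1 + 1 := by
    intro i
    induction i with
    | zero => intro _; simp
    | succ i ih =>
      intro hi
      have h1 := hstep _ _ (hc ⟨i, by omega⟩).1
      have h2 := ih (by omega)
      simp only [Fin.castSucc_mk, Fin.succ_mk] at h1
      rw [h1, h2]
      simp only [Nat.even_add_one]
      have h3 : ∀ y : Fin 2, y + 1 + 1 = y := by decide
      by_cases he : Even i <;> simp [he, h3]
  refine ⟨Quot.lift (fun i => (h i).2) ?_, ?_⟩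
  · rintro a b ⟨l, rfl, rfl⟩
    have := (hc (π.1 l)).2
    rw [π.apply_apply] at this
    rw [this]
  · ext1 i
    refine Prod.ext ?_ rfl
    have h1 := hsite i i.2
    have h2 := hsite m (by omega)
    have h3 : (h ⟨m, by omega⟩).1 = x := by simpa [ketPos] using hx
    rw [h3] at h2
    have h4 : ∀ y : Fin 2, y + 1 + 1 = y := by decide
    simp only [historyOf, siteAt, Nat.even_add]
    simp only [Fin.eta] at h1
    rw [h1, h2]
    by_cases hm : Even m <;> by_cases hi : Even (i : ℕ) <;> simp [hm, hi, h4]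

open Classical in
lemma graphContribution_eq_sum {N : ℕ} (ψ : Fin 2 × Fin N → ℂ) {n m : ℕ} {π : Pairing (m + n)}
    (hπ : ¬ HasCrossing π) (x : Fin 2) (t lam : ℝ) :
    graphContribution ψ π x t lam = (lam : ℂ) ^ (n + m) *
      ∑ ω : EnergyVar π → Fin N, amplitude n m t (fun i => energy N (ω (EnergyVar.mk π i))) *
        ((‖ψ (if Even n then x else x + 1, ω (rootClass π))‖ ^ 2 : ℝ) : ℂ) *
          (1 / (N : ℂ)) ^ π.openings.card := by
  unfold graphContribution
  congr 1
  simp only [graphFunction_eq, mul_ite, mul_zero]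
  rw [← Finset.sum_filter, Finset.filter_filter]
  refine (Finset.sum_bij (fun ω _ => historyOf π x ω) (fun ω _ => ?_) (fun ω _ ω' _ h => ?_)
    (fun h hh => ?_) fun ω _ => ?_).symm
  · refine Finset.mem_filter.2 ⟨Finset.mem_univ _, ?_, isCompatible_historyOf hπ x ω⟩
    simp [historyOf, siteAt, ketPos]
  · funext v
    obtain ⟨i, rfl⟩ := EnergyVar.exists_mk π v
    exact congrArg Prod.snd (congrFun h i)
  · obtain ⟨_, h1, h2⟩ := Finset.mem_filter.1 hh
    obtain ⟨ω, hω⟩ := exists_eq_historyOf h2 h1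
    exact ⟨ω, Finset.mem_univ _, hω⟩
  · have : siteAt m x (ketPos n m (Fin.last n)) = if Even n then x else x + 1 := by
      simp only [siteAt, ketPos, Fin.val_last]
      congr 1
      simp only [Nat.even_iff, eq_iff_iff]
      omega
    simp only [historyOf, this, rootClass]

/-! ### The limit of infinitely many levels -/

lemma tendsto_equidistant_sum (c : ℝ) :
    Tendsto (fun N : ℕ => ∑ a : Fin N, 1 / (N : ℂ) * Complex.exp (-Complex.I * (energy N a * c : ℝ)))
      atTop (𝓝 (∫ e in Set.Icc (0 : ℝ) 1, Complex.exp (-Complex.I * (e * c : ℝ)))) := by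
  set f : ℝ → ℂ := fun e => Complex.exp (-Complex.I * (e * c : ℝ)) with hf
  have hcont : Continuous f := by fun_prop
  have hlip : ∀ x y, ‖f x - f y‖ ≤ |c| * |x - y| := by
    intro x y
    have h1 : f x - f y = f y * (Complex.exp (Complex.I * (-((x - y) * c) : ℝ)) - 1) := by
      simp only [hf]
      rw [mul_sub, ← Complex.exp_add, mul_one]
      congr 2
      push_cast
      ring
    have h2 : ‖f y‖ = 1 := by
      simp only [hf]
      rw [Complex.norm_exp]
      simp
    rw [h1, norm_mul, h2, one_mul]
    refine Real.norm_exp_I_mul_ofReal_sub_one_le.trans ?_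
    rw [Real.norm_eq_abs, abs_neg, abs_mul, mul_comm]
  have hbound : ∀ N : ℕ, 0 < N → ‖∑ a : Fin N, 1 / (N : ℂ) * f (energy N a) -
      ∫ e in Set.Icc (0 : ℝ) 1, f e‖ ≤ |c| * (1 / N) := by
    intro N hN
    have hN' : (0 : ℝ) < N := by exact_mod_cast hN
    have hsum : ∫ e in Set.Icc (0 : ℝ) 1, f e =
        ∑ a ∈ Finset.range N, ∫ e in ((a : ℝ) / N)..((a + 1 : ℕ) : ℝ) / N, f e := by
      rw [intervalIntegral.sum_integral_adjacent_intervals (a := fun a : ℕ => (a : ℝ) / N)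
        fun a _ => hcont.intervalIntegrable _ _, integral_Icc_eq_integral_Ioc,
        ← intervalIntegral.integral_of_le zero_le_one]
      simp [hN'.ne']
    rw [hsum, ← Fin.sum_univ_eq_sum_range
      (fun a : ℕ => ∫ e in ((a : ℝ) / N)..((a + 1 : ℕ) : ℝ) / N, f e), ← Finset.sum_sub_distrib]
    have hterm : ∀ a : Fin N, ‖1 / (N : ℂ) * f (energy N a) -
        ∫ e in (((a : ℕ) : ℝ) / N)..(((a : ℕ) + 1 : ℕ) : ℝ) / N, f e‖ ≤ |c| * (1 / N) * (1 / N) := by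
      intro a
      have hlen : (((a : ℕ) + 1 : ℕ) : ℝ) / N - ((a : ℕ) : ℝ) / N = 1 / N := by
        push_cast
        ring
      have hconst : 1 / (N : ℂ) * f (energy N a) =
          ∫ _e in (((a : ℕ) : ℝ) / N)..(((a : ℕ) + 1 : ℕ) : ℝ) / N, f (energy N a) := by
        rw [intervalIntegral.integral_const, hlen, Complex.real_smul]
        push_cast
        rfl
      rw [hconst, ← intervalIntegral.integral_sub (by simp) (hcont.intervalIntegrable _ _)]
      refine (intervalIntegral.norm_integral_le_of_norm_le_const (C := |c| * (1 / N))
        fun e he => ?_).trans ?_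
      · have hle : ((a : ℕ) : ℝ) / N ≤ (((a : ℕ) + 1 : ℕ) : ℝ) / N := by
          rw [← sub_nonneg, hlen]
          positivity
        rw [Set.uIoc_of_le hle] at he
        refine (hlip _ _).trans (mul_le_mul_of_nonneg_left ?_ (abs_nonneg c))
        have he2 : energy N a = (((a : ℕ) + 1 : ℕ) : ℝ) / N := by simp [energy]
        rw [he2, abs_of_nonneg (by linarith [he.2])]
        linarith [he.1]
      · rw [hlen, abs_of_pos (a := 1 / (N : ℝ)) (by positivity)]
    refine (norm_sum_le_of_le _ fun a _ => hterm a).trans ?_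
    rw [Finset.sum_const, Finset.card_univ, Fintype.card_fin, nsmul_eq_mul]
    field_simp
    rfl
  rw [tendsto_iff_norm_sub_tendsto_zero]
  refine squeeze_zero' (Eventually.of_forall fun _ => norm_nonneg _)
    ((eventually_gt_atTop 0).mono fun N hN => hbound N hN) ?_
  simpa using (tendsto_one_div_atTop_nhds_zero_nat (𝕜 := ℝ)).const_mul |c|

namespace IsInitialData

variable {ε : ℝ} {ψ : (N : ℕ) → Fin 2 × Fin N → ℂ} {ρ : Fin 2 → Measure ℝ}

lemma tendsto_sum_exp (h : IsInitialData ε ψ ρ) (x : Fin 2) (c : ℝ) :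
    Tendsto (fun N : ℕ => ∑ a : Fin N, ((‖ψ N (x, a)‖ ^ 2 : ℝ) : ℂ) *
        Complex.exp (-Complex.I * (energy N a * c : ℝ)))
      atTop (𝓝 (∫ e, Complex.exp (-Complex.I * (e * c : ℝ)) ∂(ρ x))) := by
  have := h.finite x
  have hexp : ∀ e : ℝ, Complex.exp (-Complex.I * (e * c : ℝ)) =
      (Real.cos (e * c) : ℂ) + ((-Real.sin (e * c) : ℝ) : ℂ) * Complex.I := by
    intro e
    rw [show -Complex.I * ((e * c : ℝ) : ℂ) = ((-(e * c) : ℝ) : ℂ) * Complex.I by push_cast; ring,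
      Complex.exp_mul_I, ← Complex.ofReal_cos, ← Complex.ofReal_sin, Real.cos_neg, Real.sin_neg]
  let f : ℝ →ᵇ ℝ := BoundedContinuousFunction.ofNormedAddCommGroup (fun e => Real.cos (e * c))
    (by fun_prop) 1 fun e => Real.abs_cos_le_one _
  let g : ℝ →ᵇ ℝ := BoundedContinuousFunction.ofNormedAddCommGroup (fun e => -Real.sin (e * c))
    (by fun_prop) 1 fun e => by rw [norm_neg]; exact Real.abs_sin_le_one _
  have hf := (Complex.continuous_ofReal.tendsto _).comp (h.weak_limit x f)
  have hg := ((Complex.continuous_ofReal.tendsto _).comp (h.weak_limit x g)).mul_const Complex.I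
  have hfg := hf.add hg
  simp only [hexp]
  rw [integral_add (f.integrable _).ofReal ((g.integrable _).ofReal.mul_const _),
    integral_mul_const, integral_complex_ofReal, integral_complex_ofReal]
  refine hfg.congr fun N => ?_
  simp only [Function.comp_apply, Complex.ofReal_sum, Finset.sum_mul, ← Finset.sum_add_distrib]
  refine Finset.sum_congr rfl fun a _ => ?_
  simp only [f, g, BoundedContinuousFunction.coe_ofNormedAddCommGroup, Complex.ofReal_mul]
  ring

lemma eventually_sum_le_one (h : IsInitialData ε ψ ρ) (x : Fin 2) :
    ∀ᶠ N in atTop, ∑ a, ‖ψ N (x, a)‖ ^ 2 ≤ 1 := by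
  filter_upwards [h.normalised] with N hN
  rw [Fintype.sum_prod_type] at hN
  rw [← hN]
  exact Finset.single_le_sum (f := fun x => ∑ a, ‖ψ N (x, a)‖ ^ 2)
    (fun y _ => Finset.sum_nonneg fun a _ => by positivity) (Finset.mem_univ x)

lemma measureReal_univ_le_one (h : IsInitialData ε ψ ρ) (x : Fin 2) : (ρ x).real Set.univ ≤ 1 := by
  have h1 := h.weak_limit x (BoundedContinuousFunction.const ℝ 1)
  simp only [BoundedContinuousFunction.const_apply, mul_one, integral_const, smul_eq_mul] at h1
  exact le_of_tendsto h1 (h.eventually_sum_le_one x)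

lemma ae_mem_Icc (h : IsInitialData ε ψ ρ) (x : Fin 2) :
    ∀ᵐ e ∂(ρ x), e ∈ Set.Icc ε (1 - ε) := by
  have := h.finite x
  let f : ℝ →ᵇ ℝ := BoundedContinuousFunction.ofNormedAddCommGroup
    (fun e => min 1 (max (ε - e) 0 + max (e - (1 - ε)) 0)) (by fun_prop) 1 fun e => by
      rw [Real.norm_eq_abs, abs_of_nonneg (by positivity)]
      exact min_le_left _ _
  have hf0 : ∀ e, 0 ≤ f e := fun e => by
    simp only [f, BoundedContinuousFunction.coe_ofNormedAddCommGroup]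
    positivity
  have hlim : Tendsto (fun N => ∑ a, ‖ψ N (x, a)‖ ^ 2 * f (energy N a)) atTop (𝓝 0) := by
    refine tendsto_const_nhds.congr' ?_
    filter_upwards [h.edges] with N hN
    refine (Finset.sum_eq_zero fun a _ => ?_).symm
    by_cases ha : energy N a ≤ ε ∨ 1 - ε ≤ energy N a
    · simp [hN x a ha]
    · push Not at ha
      simp only [f, BoundedContinuousFunction.coe_ofNormedAddCommGroup]
      rw [max_eq_right (by linarith), max_eq_right (by linarith)]
      simp
  have h0 := tendsto_nhds_unique (h.weak_limit x f) hlim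
  rw [integral_eq_zero_iff_of_nonneg hf0 (f.integrable _)] at h0
  filter_upwards [h0] with e he
  simp only [f, BoundedContinuousFunction.coe_ofNormedAddCommGroup, Pi.zero_apply] at he
  have h1 := le_max_left (ε - e) 0
  have h2 := le_max_right (ε - e) 0
  have h3 := le_max_left (e - (1 - ε)) 0
  have h4 := le_max_right (e - (1 - ε)) 0
  rcases min_choice 1 (max (ε - e) 0 + max (e - (1 - ε)) 0) with h5 | h5
  · rw [h5] at he
    norm_num at he
  · rw [h5] at he
    constructor <;> linarith

end IsInitialData

open Classical in
/-- The weight of an energy level in the class `v` of a graph. -/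
noncomputable def levelWeight {N n m : ℕ} (ψ : Fin 2 × Fin N → ℂ) (π : Pairing (m + n)) (x : Fin 2)
    (v : EnergyVar π) (a : Fin N) : ℂ :=
  if v = rootClass π then ((‖ψ (if Even n then x else x + 1, a)‖ ^ 2 : ℝ) : ℂ) else 1 / (N : ℂ)

lemma prod_levelWeight {N n m : ℕ} (ψ : Fin 2 × Fin N → ℂ) {π : Pairing (m + n)}
    (hπ : ¬ HasCrossing π) (x : Fin 2) (ω : EnergyVar π → Fin N) :
    ∏ v, levelWeight ψ π x v (ω v) =
      ((‖ψ (if Even n then x else x + 1, ω (rootClass π))‖ ^ 2 : ℝ) : ℂ) *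
        (1 / (N : ℂ)) ^ π.openings.card := by
  classical
  rw [← Finset.mul_prod_erase _ _ (Finset.mem_univ (rootClass π)), levelWeight, if_pos rfl,
    ← EnergyVar.card_ne_mk_last hπ, ← rootClass_eq_last, ← Finset.prod_const]
  congr 1
  refine Finset.prod_congr (by ext; simp) fun v hv => ?_
  rw [levelWeight, if_neg (Finset.mem_filter.1 hv).2]

lemma graphContribution_eq_integral {N : ℕ} (ψ : Fin 2 × Fin N → ℂ) {n m : ℕ} {π : Pairing (m + n)}
    (hπ : ¬ HasCrossing π) (x : Fin 2) {t : ℝ} (ht : 0 ≤ t) (lam : ℝ) :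
    graphContribution ψ π x t lam = (lam : ℂ) ^ (n + m) * (amplitudePrefactor n m *
      ∫ s in timeDomain n m t, ∏ v, ∑ a, levelWeight ψ π x v a *
        Complex.exp (-Complex.I * (energy N a * graphTime π v s : ℝ))) := by
  classical
  rw [graphContribution_eq_sum ψ hπ]
  congr 1
  simp only [mul_assoc, ← prod_levelWeight ψ hπ x]
  have key : ∀ ω : EnergyVar π → Fin N, amplitude n m t (fun i => energy N (ω (EnergyVar.mk π i))) =
      amplitudePrefactor n m * ∫ s in timeDomain n m t,
        ∏ v, Complex.exp (-Complex.I * (energy N (ω v) * graphTime π v s : ℝ)) := fun ω =>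
    amplitude_comp_mk π ht (EnergyVar.mk_zero_eq_mk_last π) (fun v => energy N (ω v))
  simp only [key, mul_assoc]
  rw [← Finset.mul_sum]
  congr 1
  simp only [← integral_mul_const]
  rw [← integral_finsetSum _ fun ω _ => ?_]
  · congr 1
    ext s
    rw [Finset.prod_univ_sum, Fintype.piFinset_univ]
    refine Finset.sum_congr rfl fun ω _ => ?_
    rw [Finset.prod_mul_distrib, mul_comm]
  · refine ContinuousOn.integrableOn_compact (isCompact_timeDomain n m t)
      (Continuous.continuousOn ?_)
    fun_prop

lemma norm_exp_neg_I_mul_ofReal (y : ℝ) : ‖Complex.exp (-Complex.I * (y : ℂ))‖ = 1 := by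
  rw [Complex.norm_exp]
  simp

open Classical in
/-- The limit distribution of the independent energy `v` of a graph. -/
noncomputable def limitMeasure (ρ : Fin 2 → Measure ℝ) {n m : ℕ} (π : Pairing (m + n)) (x : Fin 2)
    (v : EnergyVar π) : Measure ℝ :=
  if v = rootClass π then ρ (if Even n then x else x + 1)
  else volume.restrict (Set.Icc (0 : ℝ) 1)

lemma limitContribution_eq_integral {ρ : Fin 2 → Measure ℝ} (hρ : ∀ x, IsFiniteMeasure (ρ x))
    {n m : ℕ} (π : Pairing (m + n)) (x : Fin 2) {t : ℝ} (ht : 0 ≤ t) (lam : ℝ) :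
    limitContribution ρ π x t lam = (lam : ℂ) ^ (n + m) * (amplitudePrefactor n m *
      ∫ s in timeDomain n m t, ∏ v,
        ∫ e, Complex.exp (-Complex.I * (e * graphTime π v s : ℝ)) ∂(limitMeasure ρ π x v)) := by
  have hfin : ∀ v, IsFiniteMeasure (limitMeasure ρ π x v) := fun v => by
    unfold limitMeasure
    split_ifs <;> infer_instance
  rw [← integral_amplitude π ht (EnergyVar.mk_zero_eq_mk_last π)]
  rfl

lemma tendsto_graphContribution {ε : ℝ} {ψ : (N : ℕ) → Fin 2 × Fin N → ℂ} {ρ : Fin 2 → Measure ℝ}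
    (h : IsInitialData ε ψ ρ) {n m : ℕ} {π : Pairing (m + n)} (hπ : ¬ HasCrossing π) (x : Fin 2)
    {t : ℝ} (ht : 0 ≤ t) (lam : ℝ) :
    Tendsto (fun N => graphContribution (ψ N) π x t lam) atTop
      (𝓝 (limitContribution ρ π x t lam)) := by
  simp only [limitContribution_eq_integral h.finite π x ht lam,
    graphContribution_eq_integral _ hπ x ht lam]
  refine Tendsto.const_mul _ (Tendsto.const_mul _ ?_)
  refine tendsto_integral_filter_of_dominated_convergence (fun _ => 1) ?_ ?_
    (integrable_const _) ?_
  · exact Eventually.of_forall fun N => Continuous.aestronglyMeasurable (by fun_prop)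
  · filter_upwards [h.eventually_sum_le_one (if Even n then x else x + 1),
      eventually_gt_atTop 0] with N hN hN0
    refine Eventually.of_forall fun s => ?_
    rw [norm_prod]
    refine Finset.prod_le_one (fun _ _ => norm_nonneg _) fun v _ => ?_
    refine (norm_sum_le _ _).trans ?_
    simp only [norm_mul, norm_exp_neg_I_mul_ofReal, mul_one]
    by_cases hv : v = rootClass π
    · simpa [levelWeight, hv] using hN
    · have hN' : (N : ℝ) ≠ 0 := by positivity
      simp [levelWeight, hv, hN']
  · refine Eventually.of_forall fun s => tendsto_finsetProd _ fun v _ => ?_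
    by_cases hv : v = rootClass π
    · have h1 := h.tendsto_sum_exp (if Even n then x else x + 1) (graphTime π v s)
      have h2 : limitMeasure ρ π x v = ρ (if Even n then x else x + 1) := if_pos hv
      rw [h2]
      simpa only [levelWeight, if_pos hv] using h1
    · have h1 := tendsto_equidistant_sum (graphTime π v s)
      have h2 : limitMeasure ρ π x v = volume.restrict (Set.Icc (0 : ℝ) 1) := if_neg hv
      rw [h2]
      simpa only [levelWeight, if_neg hv] using h1

/-! ### Oscillation estimates -/

/-- The Fourier transform of the uniform distribution of levels. -/
noncomputable def levelFourier (c : ℝ) : ℂ :=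
  ∫ ω in Set.Icc (0 : ℝ) 1, Complex.exp (-Complex.I * (ω * c : ℝ))

/-- The Fourier transform of the uniform distribution of levels, centred at `e`. -/
noncomputable def oscKernel (e c : ℝ) : ℂ := Complex.exp (Complex.I * (e * c : ℝ)) * levelFourier c

@[fun_prop]
lemma continuous_levelFourier : Continuous levelFourier :=
  continuous_parametric_integral_of_continuous (by fun_prop) isCompact_Icc

@[fun_prop]
lemma continuous_oscKernel (e : ℝ) : Continuous (oscKernel e) := by
  unfold oscKernel
  fun_prop

lemma norm_oscKernel (e c : ℝ) : ‖oscKernel e c‖ = ‖levelFourier c‖ := by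
  rw [oscKernel, norm_mul, mul_comm Complex.I, Complex.norm_exp_ofReal_mul_I, one_mul]

lemma norm_levelFourier_le_one (c : ℝ) : ‖levelFourier c‖ ≤ 1 := by
  refine (norm_setIntegral_le_of_norm_le_const (C := 1) (by simp) fun ω _ =>
    (norm_exp_neg_I_mul_ofReal _).le).trans ?_
  simp

lemma levelFourier_eq {c : ℝ} (hc : c ≠ 0) :
    levelFourier c = (1 - Complex.exp (-Complex.I * c)) / (Complex.I * c) := by
  have hc' : (c : ℂ) ≠ 0 := by exact_mod_cast hc
  have h : ∀ ω : ℝ, Complex.exp (-Complex.I * (ω * c : ℝ)) = Complex.exp (-Complex.I * c * ω) := by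
    intro ω
    congr 1
    push_cast
    ring
  rw [levelFourier, integral_Icc_eq_integral_Ioc, ← intervalIntegral.integral_of_le zero_le_one]
  simp only [h]
  rw [integral_exp_mul_complex (mul_ne_zero (neg_ne_zero.2 Complex.I_ne_zero) hc')]
  simp only [Complex.ofReal_one, mul_one, Complex.ofReal_zero, mul_zero, Complex.exp_zero]
  rw [neg_mul, div_neg, ← neg_div, neg_sub]

lemma norm_levelFourier_le (c : ℝ) : ‖levelFourier c‖ ≤ 3 / (1 + |c|) := by
  have h0 := abs_nonneg c
  rw [le_div_iff₀ (by positivity)]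
  have h1 := norm_levelFourier_le_one c
  have h2 : ‖levelFourier c‖ * |c| ≤ 2 := by
    rcases eq_or_ne c 0 with rfl | hc
    · simp
    · rw [levelFourier_eq hc, norm_div, norm_mul, Complex.norm_I, one_mul, Complex.norm_real,
        Real.norm_eq_abs, div_mul_cancel₀ _ (abs_ne_zero.2 hc)]
      refine (norm_sub_le _ _).trans ?_
      rw [norm_exp_neg_I_mul_ofReal, norm_one]
      norm_num
  linarith

lemma oscKernel_eq (e : ℝ) {c : ℝ} (hc : c ≠ 0) : oscKernel e c = -Complex.I *
    ((c : ℂ)⁻¹ * Complex.exp (Complex.I * e * c) -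
      (c : ℂ)⁻¹ * Complex.exp (Complex.I * (e - 1 : ℝ) * c)) := by
  have hc' : (c : ℂ) ≠ 0 := by exact_mod_cast hc
  have h : Complex.exp (Complex.I * (e - 1 : ℝ) * c) =
      Complex.exp (Complex.I * (e * c : ℝ)) * Complex.exp (-Complex.I * c) := by
    rw [← Complex.exp_add]
    congr 1
    push_cast
    ring
  rw [oscKernel, levelFourier_eq hc, h, div_eq_mul_inv, mul_inv, Complex.inv_I]
  rw [show Complex.I * (e : ℂ) * c = Complex.I * (e * c : ℝ) by push_cast; ring]
  ring

lemma norm_integral_inv_mul_exp_le {κ a b : ℝ} (hκ : κ ≠ 0) (ha : 0 < a) (hab : a ≤ b) :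
    ‖∫ c in a..b, (c : ℂ)⁻¹ * Complex.exp (Complex.I * κ * c)‖ ≤ 2 / (|κ| * a) := by
  have hb : 0 < b := ha.trans_le hab
  have hκ' : Complex.I * (κ : ℂ) ≠ 0 := mul_ne_zero Complex.I_ne_zero (by exact_mod_cast hκ)
  have hpos : ∀ c ∈ Set.uIcc a b, 0 < c := fun c hc => by
    rw [Set.uIcc_of_le hab] at hc
    exact ha.trans_le hc.1
  have hu : ∀ c ∈ Set.uIcc a b, HasDerivAt (fun c : ℝ => (c : ℂ)⁻¹) (-((c : ℂ) ^ 2)⁻¹) c := by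
    intro c hc
    have h := (hasDerivAt_inv (x := (c : ℂ)) (by exact_mod_cast (hpos c hc).ne')).comp_ofReal
    simpa using h
  have hv : ∀ c ∈ Set.uIcc a b, HasDerivAt
      (fun c : ℝ => Complex.exp (Complex.I * κ * c) / (Complex.I * κ))
      (Complex.exp (Complex.I * κ * c)) c := by
    intro c _
    have h1 : HasDerivAt (fun z : ℂ => Complex.I * κ * z) (Complex.I * κ) (c : ℂ) := by
      simpa using (hasDerivAt_id (c : ℂ)).const_mul (Complex.I * (κ : ℂ))
    have h2 := (h1.cexp.div_const (Complex.I * κ)).comp_ofReal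
    rwa [mul_div_cancel_right₀ _ hκ'] at h2
  have hu' : ContinuousOn (fun c : ℝ => -((c : ℂ) ^ 2)⁻¹) (Set.uIcc a b) := by
    refine (ContinuousOn.inv₀ (by fun_prop) fun c hc => ?_).neg
    exact pow_ne_zero 2 (by exact_mod_cast (hpos c hc).ne')
  rw [intervalIntegral.integral_mul_deriv_eq_deriv_mul hu hv hu'.intervalIntegrable
    (Continuous.intervalIntegrable (by fun_prop) _ _)]
  have hexp : ∀ c : ℝ, ‖Complex.exp (Complex.I * κ * c) / (Complex.I * κ)‖ = |κ|⁻¹ := by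
    intro c
    rw [norm_div, norm_mul Complex.I, Complex.norm_I, one_mul, Complex.norm_real, Real.norm_eq_abs,
      show Complex.I * (κ : ℂ) * c = ((κ * c : ℝ) : ℂ) * Complex.I by push_cast; ring,
      Complex.norm_exp_ofReal_mul_I, one_div]
  have hint : ‖∫ c in a..b, -((c : ℂ) ^ 2)⁻¹ *
      (Complex.exp (Complex.I * κ * c) / (Complex.I * κ))‖ ≤ |κ|⁻¹ * (a⁻¹ - b⁻¹) := by
    have hint1 : ∫ c in a..b, |κ|⁻¹ * (c ^ 2)⁻¹ = |κ|⁻¹ * (a⁻¹ - b⁻¹) := by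
      have hderiv : ∀ c ∈ Set.uIcc a b, HasDerivAt (fun c : ℝ => -c⁻¹) ((c ^ 2)⁻¹) c := by
        intro c hc
        have h := (hasDerivAt_inv (hpos c hc).ne').neg
        rwa [neg_neg] at h
      rw [intervalIntegral.integral_const_mul,
        intervalIntegral.integral_eq_sub_of_hasDerivAt hderiv]
      · ring
      · refine ContinuousOn.intervalIntegrable ?_
        exact ContinuousOn.inv₀ (by fun_prop) fun c hc => pow_ne_zero 2 (hpos c hc).ne'
    rw [← hint1]
    refine intervalIntegral.norm_integral_le_of_norm_le hab (Eventually.of_forall fun c _ => ?_) ?_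
    · rw [norm_mul, hexp, norm_neg, norm_inv, norm_pow, Complex.norm_real, Real.norm_eq_abs,
        sq_abs, mul_comm]
    · refine ContinuousOn.intervalIntegrable (ContinuousOn.mul continuousOn_const ?_)
      exact ContinuousOn.inv₀ (by fun_prop) fun c hc => pow_ne_zero 2 (hpos c hc).ne'
  refine (norm_sub_le_of_le (norm_sub_le _ _) hint).trans ?_
  rw [norm_mul, norm_mul, hexp, hexp, norm_inv, norm_inv, Complex.norm_real, Complex.norm_real,
    Real.norm_of_nonneg ha.le, Real.norm_of_nonneg hb.le, div_eq_mul_inv, mul_inv]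
  linarith

lemma norm_integral_oscKernel_le_of_one_le {ε e a b : ℝ} (hε : 0 < ε) (he : e ∈ Set.Icc ε (1 - ε))
    (ha : 1 ≤ a) (hab : a ≤ b) : ‖∫ c in a..b, oscKernel e c‖ ≤ 4 / ε / a := by
  obtain ⟨he1, he2⟩ := he
  have ha0 : 0 < a := by linarith
  have hint : ∀ κ : ℝ, IntervalIntegrable
      (fun c : ℝ => (c : ℂ)⁻¹ * Complex.exp (Complex.I * κ * c)) volume a b := by
    intro κ
    refine ContinuousOn.intervalIntegrable (ContinuousOn.mul ?_ (by fun_prop))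
    refine ContinuousOn.inv₀ (by fun_prop) fun c hc => ?_
    rw [Set.uIcc_of_le hab] at hc
    exact_mod_cast (ha0.trans_le hc.1).ne'
  rw [intervalIntegral.integral_congr (g := fun c : ℝ => -Complex.I *
    ((c : ℂ)⁻¹ * Complex.exp (Complex.I * e * c) -
      (c : ℂ)⁻¹ * Complex.exp (Complex.I * (e - 1 : ℝ) * c))) fun c hc => ?_]
  · rw [intervalIntegral.integral_const_mul, intervalIntegral.integral_sub (hint _) (hint _),
      norm_mul, norm_neg, Complex.norm_I, one_mul]
    refine (norm_sub_le_of_le (norm_integral_inv_mul_exp_le (by linarith) ha0 hab)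
      (norm_integral_inv_mul_exp_le (by linarith) ha0 hab)).trans ?_
    rw [abs_of_pos (by linarith), abs_of_neg (by linarith)]
    have h1 : 2 / (e * a) ≤ 2 / (ε * a) := by gcongr
    have h2 : 2 / (-(e - 1) * a) ≤ 2 / (ε * a) := by gcongr; linarith
    have h3 : 4 / ε / a = 2 / (ε * a) + 2 / (ε * a) := by
      field_simp
      norm_num
    linarith
  · rw [Set.uIcc_of_le hab] at hc
    exact oscKernel_eq e (ha0.trans_le hc.1).ne'

lemma norm_integral_oscKernel_le {ε e a b : ℝ} (hε : 0 < ε) (he : e ∈ Set.Icc ε (1 - ε))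
    (ha : 0 ≤ a) (hab : a ≤ b) : ‖∫ c in a..b, oscKernel e c‖ ≤ 10 / ε / (1 + a) := by
  have hε1 : ε ≤ 1 := by linarith [he.1, he.2]
  have hshort : ∀ a b : ℝ, ‖∫ c in a..b, oscKernel e c‖ ≤ |b - a| := fun a b => by
    simpa using intervalIntegral.norm_integral_le_of_norm_le_const (C := 1) (a := a) (b := b)
      (f := oscKernel e) fun c _ => by
        rw [norm_oscKernel]
        exact norm_levelFourier_le_one c
  rcases le_or_gt 1 a with h1 | h1
  · refine (norm_integral_oscKernel_le_of_one_le hε he h1 hab).trans ?_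
    rw [div_div, div_div, div_le_div_iff₀ (by positivity) (by positivity)]
    nlinarith
  · have h5 : 5 / ε ≤ 10 / ε / (1 + a) := by
      rw [div_div, div_le_div_iff₀ (by positivity) (by positivity)]
      nlinarith
    have h6 : 1 ≤ 1 / ε := by rwa [le_div_iff₀ hε, one_mul]
    refine le_trans ?_ h5
    rcases le_or_gt b 1 with hb | hb
    · refine (hshort a b).trans ?_
      rw [abs_of_nonneg (by linarith)]
      have : 5 / ε = 5 * (1 / ε) := by ring
      linarith
    · rw [← intervalIntegral.integral_add_adjacent_intervals (b := 1)
        ((continuous_oscKernel e).intervalIntegrable _ _)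
        ((continuous_oscKernel e).intervalIntegrable _ _)]
      refine (norm_add_le_of_le (hshort a 1)
        (norm_integral_oscKernel_le_of_one_le hε he le_rfl hb.le)).trans ?_
      rw [abs_of_nonneg (by linarith)]
      have : 5 / ε = 1 / ε + 4 / ε := by ring
      rw [div_one]
      linarith

lemma oscKernel_neg (e c : ℝ) : oscKernel e (-c) = star (oscKernel e c) := by
  simp only [oscKernel, levelFourier, Complex.star_def, map_mul]
  rw [← integral_conj]
  simp only [← Complex.exp_conj]
  simp

lemma norm_setIntegral_oscKernel_le {ε e σ a : ℝ} (L : ℝ) (hε : 0 < ε)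
    (he : e ∈ Set.Icc ε (1 - ε)) (hσ : σ = 1 ∨ σ = -1) (ha : 0 ≤ a) :
    ‖∫ s in Set.Icc 0 L, oscKernel e (σ * (s + a))‖ ≤ 10 / ε / (1 + a) := by
  have hpos : ‖∫ s in Set.Icc 0 L, oscKernel e (s + a)‖ ≤ 10 / ε / (1 + a) := by
    rcases le_or_gt 0 L with hL | hL
    · rw [integral_Icc_eq_integral_Ioc, ← intervalIntegral.integral_of_le hL,
        intervalIntegral.integral_comp_add_right, zero_add]
      exact norm_integral_oscKernel_le hε he ha (by linarith)
    · rw [Set.Icc_eq_empty (by linarith), Measure.restrict_empty, integral_zero_measure, norm_zero]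
      positivity
  rcases hσ with rfl | rfl
  · simpa using hpos
  · simp only [neg_mul, one_mul, oscKernel_neg, Complex.star_def]
    rw [integral_conj, RCLike.norm_conj]
    exact hpos

lemma integral_inv_one_add_abs_le {σ t : ℝ} (c : ℝ) (hσ : σ = 1 ∨ σ = -1) (ht : 2 ≤ t) :
    ∫ x in Set.Icc 0 t, 3 / (1 + |σ * x + c|) ≤ 12 * Real.log t := by
  have hne : ∀ y : ℝ, (1 + |y|) ≠ 0 := fun y => by positivity
  set y : ℝ := max 0 (min t (-(σ * c))) with hy
  have hy0 : 0 ≤ y := le_max_left _ _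
  have hyt : y ≤ t := max_le (by linarith) (min_le_left _ _)
  have hle : ∀ x ∈ Set.Icc 0 t, |x - y| ≤ |σ * x + c| := by
    intro x hx
    have h1 : |σ * x + c| = |x - -(σ * c)| := by
      rcases hσ with rfl | rfl
      · congr 1
        ring
      · rw [← abs_neg]
        congr 1
        ring
    rw [h1, hy]
    rcases le_total (-(σ * c)) 0 with h | h
    · rw [max_eq_left ((min_le_right _ _).trans h), sub_zero, abs_of_nonneg hx.1,
        abs_of_nonneg (by linarith [hx.1])]
      linarith
    · rcases le_total t (-(σ * c)) with h' | h'
      · rw [min_eq_left h', max_eq_right (by linarith), abs_of_nonpos (by linarith [hx.2]),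
          abs_of_nonpos (by linarith [hx.2])]
        linarith
      · rw [min_eq_right h', max_eq_right h]
  have hlog : ∀ b, 0 ≤ b → ∫ x in (0 : ℝ)..b, (1 + x)⁻¹ = Real.log (1 + b) := by
    intro b hb
    rw [intervalIntegral.integral_comp_add_left (fun x => x⁻¹) 1, add_zero,
      integral_inv_of_pos one_pos (by linarith), div_one]
  have hmain : ∫ x in (0 : ℝ)..t, (1 + |x - y|)⁻¹ = Real.log (1 + y) + Real.log (1 + (t - y)) := by
    have hcont : Continuous fun x : ℝ => (1 + |x - y|)⁻¹ :=
      Continuous.inv₀ (by fun_prop) fun x => hne _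
    rw [← intervalIntegral.integral_add_adjacent_intervals (b := y)
      (hcont.intervalIntegrable _ _) (hcont.intervalIntegrable _ _), ← hlog y hy0,
      ← hlog (t - y) (by linarith)]
    congr 1
    · have h1 := intervalIntegral.integral_comp_sub_left (a := 0) (b := y)
        (fun x : ℝ => (1 + x)⁻¹) y
      rw [sub_self, sub_zero] at h1
      rw [← h1]
      refine intervalIntegral.integral_congr fun x hx => ?_
      rw [Set.uIcc_of_le hy0] at hx
      rw [abs_of_nonpos (by linarith [hx.2]), neg_sub]
    · have h1 := intervalIntegral.integral_comp_sub_right (a := y) (b := t)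
        (fun x : ℝ => (1 + x)⁻¹) y
      rw [sub_self] at h1
      rw [← h1]
      refine intervalIntegral.integral_congr fun x hx => ?_
      rw [Set.uIcc_of_le hyt] at hx
      rw [abs_of_nonneg (by linarith [hx.1])]
  have hcont2 : Continuous fun x : ℝ => 3 / (1 + |σ * x + c|) :=
    Continuous.div (by fun_prop) (by fun_prop) fun x => hne _
  have hcont3 : Continuous fun x : ℝ => 3 * (1 + |x - y|)⁻¹ :=
    Continuous.mul (by fun_prop) (Continuous.inv₀ (by fun_prop) fun x => hne _)
  refine (setIntegral_mono_on hcont2.integrableOn_Icc hcont3.integrableOn_Icc measurableSet_Icc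
    fun x hx => ?_).trans ?_
  · rw [div_eq_mul_inv]
    have := hle x hx
    gcongr
  · rw [integral_Icc_eq_integral_Ioc, ← intervalIntegral.integral_of_le (by linarith),
      intervalIntegral.integral_const_mul, hmain]
    have h1 : Real.log (1 + y) ≤ Real.log (t ^ 2) :=
      Real.log_le_log (by linarith) (by nlinarith)
    have h2 : Real.log (1 + (t - y)) ≤ Real.log (t ^ 2) :=
      Real.log_le_log (by linarith) (by nlinarith)
    rw [Real.log_pow] at h1 h2
    push_cast at h1 h2
    linarith

lemma lintegral_inv_one_add_abs_le {σ t : ℝ} (c : ℝ) (hσ : σ = 1 ∨ σ = -1) (ht : 2 ≤ t) :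
    ∫⁻ x in Set.Icc 0 t, ENNReal.ofReal (3 / (1 + |σ * x + c|)) ≤
      ENNReal.ofReal (12 * Real.log t) := by
  have hcont : Continuous fun x : ℝ => 3 / (1 + |σ * x + c|) :=
    Continuous.div (by fun_prop) (by fun_prop) fun x => by positivity
  rw [← ofReal_integral_eq_lintegral_ofReal hcont.integrableOn_Icc
    (Eventually.of_forall fun x => by positivity)]
  exact ENNReal.ofReal_le_ofReal (integral_inv_one_add_abs_le c hσ ht)

/-! ### Integration over the free times -/

lemma lintegral_pi_prod_le {J V : Type*} [Fintype J] [DecidableEq J] {t : ℝ}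
    {M : ENNReal} (S : Finset V) (p : V → J) (hp : Set.InjOn p S) (G : V → (J → ℝ) → ENNReal)
    (hG : ∀ v, Measurable (G v))
    (hint : ∀ v ∈ S, ∀ x, ∫⁻ y in Set.Icc 0 t, G v (Function.update x (p v) y) ≤ M)
    (hindep : ∀ u ∈ S, ∀ v ∈ S, u ≠ v → ∀ x y, G u (Function.update x (p v) y) = G u x) :
    ∫⁻ s, ∏ v ∈ S, G v s ∂(Measure.pi fun _ : J => volume.restrict (Set.Icc 0 t)) ≤
      M ^ S.card * ENNReal.ofReal t ^ (Fintype.card J - S.card) := by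
  classical
  have hmeas : ∀ S' : Finset V, Measurable fun s => ∏ v ∈ S', G v s := fun S' =>
    Finset.measurable_prod _ fun v _ => hG v
  have key : ∀ S' ⊆ S, ∀ x, (∫⋯∫⁻_S'.image p, (fun s => ∏ v ∈ S, G v s)
      ∂(fun _ : J => (volume : Measure ℝ).restrict (Set.Icc 0 t))) x ≤
        M ^ S'.card * ∏ v ∈ S \ S', G v x := by
    intro S'
    induction S' using Finset.induction_on with
    | empty => intro _ x; simp
    | insert v S' hv ih =>
      intro hS x
      have hvS : v ∈ S := hS (Finset.mem_insert_self _ _)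
      have hS'S : S' ⊆ S := (Finset.subset_insert _ _).trans hS
      have hpv : p v ∉ S'.image p := by
        intro h
        obtain ⟨u, hu, huv⟩ := Finset.mem_image.1 h
        exact hv (hp (hS'S hu) hvS huv ▸ hu)
      rw [Finset.image_insert, lmarginal_insert _ (hmeas S) hpv]
      have hsplit : S \ S' = insert v (S \ insert v S') := by
        ext u
        simp only [Finset.mem_sdiff, Finset.mem_insert]
        by_cases huv : u = v
        · subst huv
          simp [hvS, hv]
        · simp [huv]
      calc _ ≤ ∫⁻ y in Set.Icc 0 t, M ^ S'.card * (∏ u ∈ S \ insert v S', G u x) *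
            G v (Function.update x (p v) y) := by
            refine lintegral_mono fun y => (ih hS'S _).trans ?_
            rw [hsplit, Finset.prod_insert (by simp), mul_assoc]
            refine mul_le_mul_right ?_ _
            rw [mul_comm]
            refine (congrArg (· * _) (Finset.prod_congr rfl fun u hu => ?_)).le
            simp only [Finset.mem_sdiff, Finset.mem_insert, not_or] at hu
            exact hindep u hu.1 v hvS hu.2.1 _ _
        _ = M ^ S'.card * (∏ u ∈ S \ insert v S', G u x) *
            ∫⁻ y in Set.Icc 0 t, G v (Function.update x (p v) y) :=
            lintegral_const_mul _ ((hG v).comp (measurable_update x))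
        _ ≤ M ^ S'.card * (∏ u ∈ S \ insert v S', G u x) * M :=
            mul_le_mul_right (hint v hvS x) _
        _ = _ := by
            rw [Finset.card_insert_of_notMem hv, pow_succ]
            ring
  have hdisj : Disjoint (Finset.univ \ S.image p) (S.image p) := Finset.sdiff_disjoint
  rw [lintegral_eq_lmarginal_univ (fun _ => 0),
    ← Finset.sdiff_union_of_subset (Finset.subset_univ (S.image p)),
    lmarginal_union _ _ (hmeas S) hdisj]
  refine (lmarginal_mono (g := fun _ => M ^ S.card) (fun x => ?_) _).trans ?_
  · simpa using key S subset_rfl x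
  · rw [lmarginal, lintegral_const, Measure.pi_univ]
    simp only [Measure.restrict_apply MeasurableSet.univ, Set.univ_inter, Real.volume_Icc, sub_zero]
    rw [Finset.prod_const, Finset.card_univ, Fintype.card_coe, Finset.card_sdiff_of_subset
      (Finset.subset_univ _), Finset.card_image_of_injOn hp, Finset.card_univ]

section Extend

variable {J : Type*} [DecidableEq J]

/-- Insert the coordinate `y` at `j₁`. -/
def extendAt (j₁ : J) (y : ℝ) (s : {j // j ≠ j₁} → ℝ) : J → ℝ :=
  fun j => if h : j = j₁ then y else s ⟨j, h⟩

@[simp] lemma extendAt_self (j₁ : J) (y : ℝ) (s : {j // j ≠ j₁} → ℝ) : extendAt j₁ y s j₁ = y := by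
  simp [extendAt]

lemma extendAt_of_ne {j₁ j : J} (h : j ≠ j₁) (y : ℝ) (s : {j // j ≠ j₁} → ℝ) :
    extendAt j₁ y s j = s ⟨j, h⟩ := by
  simp [extendAt, h]

lemma update_extendAt (j₁ : J) (x y : ℝ) (s : {j // j ≠ j₁} → ℝ) :
    Function.update (extendAt j₁ x s) j₁ y = extendAt j₁ y s := by
  ext j
  by_cases h : j = j₁
  · subst h; simp
  · simp [Function.update_of_ne h, extendAt_of_ne h]

lemma extendAt_update (j₁ : J) (x y : ℝ) (s : {j // j ≠ j₁} → ℝ) (j : {j // j ≠ j₁}) :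
    extendAt j₁ x (Function.update s j y) = Function.update (extendAt j₁ x s) j y := by
  ext i
  by_cases h : i = j₁
  · subst h
    simp [Function.update_of_ne j.2.symm]
  · rw [extendAt_of_ne h]
    by_cases hij : i = j
    · subst hij
      simp
    · rw [Function.update_of_ne hij, extendAt_of_ne h,
        Function.update_of_ne fun h => hij (congrArg Subtype.val h)]

@[fun_prop]
lemma measurable_extendAt (j₁ : J) (y : ℝ) : Measurable (extendAt j₁ y) := by
  refine measurable_pi_lambda _ fun j => ?_
  by_cases h : j = j₁
  · subst h
    simp
  · simp only [extendAt_of_ne h]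
    fun_prop

lemma integral_eq_integral_extendAt [Fintype J] (j₁ : J) {F : (J → ℝ) → ℂ} (hF : Integrable F) :
    ∫ s, F s = ∫ s, ∫ y, F (extendAt j₁ y s) := by
  have h1 : MeasurePreserving (MeasurableEquiv.piEquivPiSubtypeProd (fun _ : J => ℝ)
      (fun j => j = j₁)) volume ((volume : Measure ({j // j = j₁} → ℝ)).prod
        (volume : Measure ({j // j ≠ j₁} → ℝ))) := by
    rw [← Measure.volume_eq_prod]
    convert volume_preserving_piEquivPiSubtypeProd (fun _ : J => ℝ) (fun j => j = j₁)
    rfl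
  have h2 := (volume_preserving_funUnique {j // j = j₁} ℝ).prod
    (MeasurePreserving.id (volume : Measure ({j // j ≠ j₁} → ℝ)))
  let Φ : (J → ℝ) ≃ᵐ ℝ × ({j // j ≠ j₁} → ℝ) :=
    (MeasurableEquiv.piEquivPiSubtypeProd (fun _ : J => ℝ) (fun j => j = j₁)).trans
      ((MeasurableEquiv.funUnique {j // j = j₁} ℝ).prodCongr (MeasurableEquiv.refl _))
  have hΦ : MeasurePreserving Φ volume (volume.prod volume) := h2.comp h1
  have hsymm : ∀ q, Φ.symm q = extendAt j₁ q.1 q.2 := by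
    intro q
    rw [MeasurableEquiv.symm_apply_eq]
    refine Prod.ext ?_ ?_
    · change q.1 = extendAt j₁ q.1 q.2 j₁
      simp
    · funext j
      change q.2 j = extendAt j₁ q.1 q.2 j
      rw [extendAt_of_ne j.2]
  have h3 := hΦ.symm.integral_comp' F
  have h4 : Integrable (fun q : ℝ × ({j // j ≠ j₁} → ℝ) => F (Φ.symm q)) (volume.prod volume) :=
    (hΦ.symm.integrable_comp_emb (MeasurableEquiv.measurableEmbedding _)).2 hF
  rw [← h3, integral_prod_symm _ h4]
  simp only [hsymm]

end Extend

section ClassTimeBound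

variable {J V : Type*} [Fintype J] [DecidableEq J]

lemma classTime_update_of_ne (sgn : J → ℝ) (cls : J → V) {v : V} {j : J} (h : cls j ≠ v)
    (s : J → ℝ) (y : ℝ) : classTime sgn cls v (Function.update s j y) = classTime sgn cls v s := by
  classical
  refine Finset.sum_congr rfl fun i hi => ?_
  rw [Function.update_of_ne]
  rintro rfl
  exact h (Finset.mem_filter.1 hi).2

lemma classTime_update (sgn : J → ℝ) (cls : J → V) {v : V} {j : J} (h : cls j = v)
    (s : J → ℝ) (y : ℝ) : classTime sgn cls v (Function.update s j y) =
      sgn j * y + classTime sgn cls v (Function.update s j 0) := by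
  classical
  subst h
  unfold classTime
  rw [← Finset.add_sum_erase _ _ (a := j) (by simp),
    ← Finset.add_sum_erase _ (fun i => sgn i * Function.update s j 0 i) (a := j) (by simp)]
  simp only [Function.update_self, mul_zero, zero_add]
  congr 1
  refine Finset.sum_congr rfl fun i hi => ?_
  rw [Function.update_of_ne (Finset.ne_of_mem_erase hi),
    Function.update_of_ne (Finset.ne_of_mem_erase hi)]

omit [DecidableEq J] in
lemma classTime_eq_mul_abs {sgn : J → ℝ} {cls : J → V} {v : V} {σ : ℝ} (hσ : σ = 1 ∨ σ = -1)
    (hv : ∀ j, cls j = v → sgn j = σ) {s : J → ℝ} (hs : ∀ j, 0 ≤ s j) :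
    classTime sgn cls v s = σ * |classTime sgn cls v s| := by
  classical
  have h : classTime sgn cls v s = σ * ∑ j with cls j = v, s j := by
    rw [classTime, Finset.mul_sum]
    exact Finset.sum_congr rfl fun j hj => by rw [hv j (Finset.mem_filter.1 hj).2]
  rw [h, abs_mul, abs_of_nonneg (Finset.sum_nonneg fun j _ => hs j)]
  rcases hσ with rfl | rfl <;> simp

lemma norm_setIntegral_prod_oscKernel_le {sgn : J → ℝ} {cls : J → V} {D : Set (J → ℝ)}
    (hD : IsCompact D) {j₁ : J} {A : Set ({j // j ≠ j₁} → ℝ)} {L : ({j // j ≠ j₁} → ℝ) → ℝ} {t : ℝ}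
    (hDA : ∀ y s, extendAt j₁ y s ∈ D ↔ y ∈ Set.Icc 0 (L s) ∧ s ∈ A)
    (hDt : D ⊆ Set.Icc 0 (fun _ => t)) (hsgn : ∀ j, sgn j = 1 ∨ sgn j = -1) (U : Finset V)
    (hU : cls j₁ ∈ U) (hw : ∀ j, cls j = cls j₁ → sgn j = sgn j₁)
    (hrep : ∀ v ∈ U, ∃ j, j ≠ j₁ ∧ cls j = v) {ε e : ℝ} (hε : 0 < ε) (he : e ∈ Set.Icc ε (1 - ε))
    (ht : 2 ≤ t) :
    ‖∫ s in D, ∏ v ∈ U, oscKernel e (classTime sgn cls v s)‖ ≤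
      10 / ε * ((12 * Real.log t) ^ U.card * t ^ (Fintype.card J - 1 - U.card)) := by
  classical
  have hlog : 0 ≤ Real.log t := Real.log_nonneg (by linarith)
  set c : V → ({j // j ≠ j₁} → ℝ) → ℝ := fun v s => classTime sgn cls v (extendAt j₁ 0 s) with hc
  set G : V → ({j // j ≠ j₁} → ℝ) → ENNReal := fun v s =>
    ENNReal.ofReal (3 / (1 + |c v s|)) with hG
  have hcont : Continuous fun s => ∏ v ∈ U, oscKernel e (classTime sgn cls v s) := by fun_prop
  have hinner : ∀ s, ‖∫ y, D.indicator (fun s => ∏ v ∈ U, oscKernel e (classTime sgn cls v s))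
      (extendAt j₁ y s)‖ₑ ≤ (Set.Icc (0 : {j // j ≠ j₁} → ℝ) (fun _ => t)).indicator
        (fun s => ENNReal.ofReal (10 / ε) * ∏ v ∈ U, G v s) s := by
    intro s
    by_cases hs : ∃ y, extendAt j₁ y s ∈ D
    · obtain ⟨y₀, hy₀⟩ := hs
      have hsA : s ∈ A := ((hDA _ _).1 hy₀).2
      have hs0 : ∀ j, 0 ≤ s j := fun j => by
        have := (hDt hy₀).1 j
        rwa [extendAt_of_ne j.2] at this
      have hsI : s ∈ Set.Icc (0 : {j // j ≠ j₁} → ℝ) (fun _ => t) := by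
        refine ⟨hs0, fun j => ?_⟩
        have := (hDt hy₀).2 j
        rwa [extendAt_of_ne j.2] at this
      have hs0' : ∀ j, 0 ≤ extendAt j₁ 0 s j := fun j => by
        by_cases h : j = j₁
        · subst h; simp
        · rw [extendAt_of_ne h]
          exact hs0 _
      rw [Set.indicator_of_mem hsI]
      have h1 : ∀ y, D.indicator (fun s => ∏ v ∈ U, oscKernel e (classTime sgn cls v s))
          (extendAt j₁ y s) = (Set.Icc 0 (L s)).indicator (fun y =>
            oscKernel e (sgn j₁ * (y + |c (cls j₁) s|)) *
              ∏ v ∈ U.erase (cls j₁), oscKernel e (c v s)) y := by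
        intro y
        by_cases hy : y ∈ Set.Icc 0 (L s)
        · rw [Set.indicator_of_mem hy, Set.indicator_of_mem ((hDA _ _).2 ⟨hy, hsA⟩),
            ← Finset.mul_prod_erase _ _ hU]
          congr 1
          · rw [← update_extendAt j₁ 0 y s, classTime_update _ _ rfl, update_extendAt, mul_add,
              ← classTime_eq_mul_abs (hsgn j₁) hw hs0']
          · refine Finset.prod_congr rfl fun v hv => ?_
            rw [← update_extendAt j₁ 0 y s,
              classTime_update_of_ne _ _ (Finset.ne_of_mem_erase hv).symm]
        · rw [Set.indicator_of_notMem hy, Set.indicator_of_notMem]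
          exact fun h => hy ((hDA _ _).1 h).1
      simp only [h1]
      rw [integral_indicator measurableSet_Icc, integral_mul_const, ← ofReal_norm,
        norm_mul, norm_prod]
      simp only [hG]
      rw [← ENNReal.ofReal_prod_of_nonneg fun v _ => by positivity,
        ← ENNReal.ofReal_mul (by positivity)]
      refine ENNReal.ofReal_le_ofReal ?_
      rw [← Finset.mul_prod_erase U _ hU, ← mul_assoc]
      refine mul_le_mul ?_ (Finset.prod_le_prod (fun _ _ => norm_nonneg _) fun v _ => ?_)
        (Finset.prod_nonneg fun _ _ => norm_nonneg _) (by positivity)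
      · refine (norm_setIntegral_oscKernel_le (L s) hε he (hsgn j₁) (abs_nonneg _)).trans ?_
        rw [div_eq_mul_inv (10 / ε)]
        refine mul_le_mul_of_nonneg_left ?_ (by positivity)
        rw [inv_eq_one_div]
        gcongr
        norm_num
      · rw [norm_oscKernel]
        exact norm_levelFourier_le _
    · have h1 : ∀ y, D.indicator (fun s => ∏ v ∈ U, oscKernel e (classTime sgn cls v s))
          (extendAt j₁ y s) = 0 := fun y => Set.indicator_of_notMem (fun h => hs ⟨y, h⟩) _
      simp [h1]
  have hrep' : ∀ v ∈ U, ∃ j : {j // j ≠ j₁}, cls j = v := fun v hv =>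
    let ⟨j, h1, h2⟩ := hrep v hv
    ⟨⟨j, h1⟩, h2⟩
  have : Nonempty {j // j ≠ j₁} := let ⟨j, _⟩ := hrep' _ hU; ⟨j⟩
  choose! p' hcls using hrep'
  have hcrude := lintegral_pi_prod_le (t := t) (M := ENNReal.ofReal (12 * Real.log t)) U p'
    (fun u hu v hv huv => by rw [← hcls u hu, ← hcls v hv, huv]) G
    (fun v => by simp only [hG]; fun_prop) (fun v hv x => ?_) (fun u hu v hv huv x y => ?_)
  · rw [← integral_indicator hD.measurableSet, integral_eq_integral_extendAt j₁
      ((integrable_indicator_iff hD.measurableSet).2 (hcont.continuousOn.integrableOn_compact hD)),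
      ← ENNReal.ofReal_le_ofReal_iff (by positivity), ofReal_norm]
    refine (enorm_integral_le_lintegral_enorm _).trans ((lintegral_mono hinner).trans ?_)
    rw [lintegral_indicator measurableSet_Icc, lintegral_const_mul _
      (Finset.measurable_prod _ fun v _ => by simp only [hG]; fun_prop),
      ENNReal.ofReal_mul (by positivity), ENNReal.ofReal_mul (by positivity),
      ENNReal.ofReal_pow (by positivity), ENNReal.ofReal_pow (by positivity)]
    refine mul_le_mul_right ?_ _
    have hcard : Fintype.card {j // j ≠ j₁} = Fintype.card J - 1 := by
      rw [Fintype.card_subtype_compl, Fintype.card_subtype_eq]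
    rw [hcard] at hcrude
    refine le_trans (le_of_eq ?_) hcrude
    rw [← Set.pi_univ_Icc, volume_pi, Measure.restrict_pi_pi]
    rfl
  · have h1 : ∀ y, c v (Function.update x (p' v) y) = sgn (p' v) * y +
        classTime sgn cls v (Function.update (extendAt j₁ 0 x) (p' v) 0) := by
      intro y
      simp only [hc]
      rw [extendAt_update]
      rw [classTime_update _ _ (hcls v hv)]
    simp only [hG, h1]
    exact lintegral_inv_one_add_abs_le _ (hsgn _) ht
  · simp only [hG, hc]
    rw [extendAt_update, classTime_update_of_ne]
    rw [hcls v hv]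
    exact huv.symm

end ClassTimeBound

/-! ### The bound for nested graphs -/

lemma extendAt_eq_add {J : Type*} [DecidableEq J] (j₁ : J) (y : ℝ) (s : {j // j ≠ j₁} → ℝ) (j : J) :
    extendAt j₁ y s j = extendAt j₁ 0 s j + if j = j₁ then y else 0 := by
  by_cases h : j = j₁
  · subst h; simp
  · simp [extendAt_of_ne h, h]

lemma extendAt_nonneg_iff {J : Type*} [DecidableEq J] (j₁ : J) (y : ℝ) (s : {j // j ≠ j₁} → ℝ) :
    (∀ j, 0 ≤ extendAt j₁ y s j) ↔ 0 ≤ y ∧ ∀ j, 0 ≤ s j := by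
  constructor
  · intro h
    refine ⟨by simpa using h j₁, fun j => ?_⟩
    have := h j
    rwa [extendAt_of_ne j.2] at this
  · rintro ⟨h0, h1⟩ j
    by_cases h : j = j₁
    · subst h; simpa
    · rw [extendAt_of_ne h]
      exact h1 _

lemma exists_mem_timeDomain_iff (n m : ℕ) (t : ℝ) (j₁ : Fin n ⊕ Fin m) :
    ∃ (A : Set ({j // j ≠ j₁} → ℝ)) (L : ({j // j ≠ j₁} → ℝ) → ℝ),
      ∀ y s, extendAt j₁ y s ∈ timeDomain n m t ↔ y ∈ Set.Icc 0 (L s) ∧ s ∈ A := by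
  have hmem : ∀ s, s ∈ timeDomain n m t ↔ (∀ j, 0 ≤ s j) ∧ ∑ i, s (Sum.inl i) ≤ t ∧
      ∑ i, s (Sum.inr i) ≤ t := by
    intro s
    rw [Sum.forall]
    exact ⟨fun h => ⟨⟨h.1.1, h.2.1⟩, h.1.2, h.2.2⟩, fun h => ⟨⟨h.1.1, h.2.1⟩, h.1.2, h.2.2⟩⟩
  rcases j₁ with a | a
  · refine ⟨{s | (∀ j, 0 ≤ s j) ∧ ∑ i, extendAt (Sum.inl a) 0 s (Sum.inr i) ≤ t},
      fun s => t - ∑ i, extendAt (Sum.inl a) 0 s (Sum.inl i), fun y s => ?_⟩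
    have h1 : ∑ i, extendAt (Sum.inl a) y s (Sum.inl i) =
        ∑ i, extendAt (Sum.inl a) 0 s (Sum.inl i) + y := by
      simp only [extendAt_eq_add _ y, Finset.sum_add_distrib, Sum.inl.injEq]
      simp
    have h2 : ∑ i, extendAt (Sum.inl a) y s (Sum.inr i) =
        ∑ i, extendAt (Sum.inl a) 0 s (Sum.inr i) := by
      simp only [extendAt_eq_add _ y, reduceCtorEq, if_false, add_zero]
    rw [hmem, extendAt_nonneg_iff, h1, h2, ← le_sub_iff_add_le', Set.mem_Icc, Set.mem_ofPred_eq]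
    tauto
  · refine ⟨{s | (∀ j, 0 ≤ s j) ∧ ∑ i, extendAt (Sum.inr a) 0 s (Sum.inl i) ≤ t},
      fun s => t - ∑ i, extendAt (Sum.inr a) 0 s (Sum.inr i), fun y s => ?_⟩
    have h1 : ∑ i, extendAt (Sum.inr a) y s (Sum.inr i) =
        ∑ i, extendAt (Sum.inr a) 0 s (Sum.inr i) + y := by
      simp only [extendAt_eq_add _ y, Finset.sum_add_distrib, Sum.inr.injEq]
      simp
    have h2 : ∑ i, extendAt (Sum.inr a) y s (Sum.inl i) =
        ∑ i, extendAt (Sum.inr a) 0 s (Sum.inl i) := by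
      simp only [extendAt_eq_add _ y, reduceCtorEq, if_false, add_zero]
    rw [hmem, extendAt_nonneg_iff, h1, h2, ← le_sub_iff_add_le', Set.mem_Icc, Set.mem_ofPred_eq]
    tauto

lemma freePos_inl_val {n m : ℕ} (i : Fin n) : (freePos n m (Sum.inl i) : ℕ) = m + i := rfl

lemma freePos_inr_val {n m : ℕ} (i : Fin m) : (freePos n m (Sum.inr i) : ℕ) = m - i := rfl

lemma exists_freePos_eq_of_ge {n m : ℕ} {p : Fin (m + n + 1)} (h1 : m ≤ p) (h2 : (p : ℕ) < m + n) :
    ∃ i : Fin n, freePos n m (Sum.inl i) = p :=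
  ⟨⟨p - m, by omega⟩, Fin.ext (by rw [freePos_inl_val]; simp only; omega)⟩

lemma exists_freePos_eq_of_lt {n m : ℕ} {p : Fin (m + n + 1)} (h1 : 0 < (p : ℕ)) (h2 : (p : ℕ) < m) :
    ∃ i : Fin m, freePos n m (Sum.inr i) = p :=
  ⟨⟨m - p, by omega⟩, Fin.ext (by rw [freePos_inr_val]; simp only; omega)⟩

lemma exists_freeClass_eq {n m : ℕ} {π : Pairing (m + n)} {v : EnergyVar π}
    (hv : v ≠ rootClass π) : ∃ j, freeClass π j = v := by
  obtain ⟨p, rfl⟩ := EnergyVar.exists_mk π v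
  rw [rootClass_eq_last] at hv
  have h0 : (p : ℕ) ≠ 0 := fun h => hv (by
    rw [show p = 0 from Fin.ext h, EnergyVar.mk_zero_eq_mk_last])
  have h1 : (p : ℕ) ≠ m + n := fun h => hv (by rw [show p = Fin.last _ from Fin.ext h])
  rcases lt_or_ge (p : ℕ) m with h | h
  · obtain ⟨i, hi⟩ := exists_freePos_eq_of_lt (by omega) h
    exact ⟨_, congrArg (EnergyVar.mk π) hi⟩
  · obtain ⟨i, hi⟩ := exists_freePos_eq_of_ge h (by omega)
    exact ⟨_, congrArg (EnergyVar.mk π) hi⟩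

/-- The energy between the two pairs of a nest occurs at least twice, on one side only. -/
lemma IsNested.exists_freeClass {n m : ℕ} {π : Pairing (m + n)} (hπ : IsNested m π) :
    ∃ j₁ j₂, j₂ ≠ j₁ ∧ freeClass π j₂ = freeClass π j₁ ∧ freeClass π j₁ ≠ rootClass π ∧
      ∀ j, freeClass π j = freeClass π j₁ → freeSign n m j = freeSign n m j₁ := by
  obtain ⟨hc, a, b, hab, hb, hba, hside⟩ := hπ
  have ha : a < π.1 a := hab.trans (hb.trans hba)
  have hmk := EnergyVar.mk_succ π a
  have hroot : EnergyVar.mk π a.succ ≠ rootClass π := by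
    rw [rootClass_eq_last]
    exact EnergyVar.mk_succ_ne_mk_last hc ha
  have hIoc := fun p => EnergyVar.mem_Ioc_of_mk_eq hc ha (a := p)
  have hlt := (π.1 a).2
  rw [Fin.lt_def] at hab hb hba
  rcases hside with h | h
  · obtain ⟨i, hi⟩ := exists_freePos_eq_of_lt (n := n) (m := m) (p := a.succ) (by simp)
      (by rw [Fin.val_succ]; omega)
    obtain ⟨j, hj⟩ := exists_freePos_eq_of_lt (n := n) (m := m) (p := (π.1 a).castSucc)
      (by rw [Fin.val_castSucc]; omega) (by rw [Fin.val_castSucc]; omega)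
    have hi' : freeClass π (Sum.inr i) = EnergyVar.mk π a.succ := congrArg _ hi
    refine ⟨Sum.inr i, Sum.inr j, ?_, ?_, ?_, ?_⟩
    · intro hij
      rw [hij, hi] at hj
      have := congrArg Fin.val hj
      simp only [Fin.val_succ, Fin.val_castSucc] at this
      omega
    · rw [hi', hmk]
      exact congrArg _ hj
    · rwa [hi']
    · rintro (l | l) hl
      · have := (hIoc _ (hl.trans hi')).2
        rw [freePos_inl_val] at this
        omega
      · rfl
  · obtain ⟨i, hi⟩ := exists_freePos_eq_of_ge (n := n) (m := m) (p := a.succ)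
      (by rw [Fin.val_succ]; omega) (by rw [Fin.val_succ]; omega)
    obtain ⟨j, hj⟩ := exists_freePos_eq_of_ge (n := n) (m := m) (p := (π.1 a).castSucc)
      (by rw [Fin.val_castSucc]; omega) (by rw [Fin.val_castSucc]; omega)
    have hi' : freeClass π (Sum.inl i) = EnergyVar.mk π a.succ := congrArg _ hi
    refine ⟨Sum.inl i, Sum.inl j, ?_, ?_, ?_, ?_⟩
    · intro hij
      rw [hij, hi] at hj
      have := congrArg Fin.val hj
      simp only [Fin.val_succ, Fin.val_castSucc] at this
      omega
    · rw [hi', hmk]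
      exact congrArg _ hj
    · rwa [hi']
    · rintro (l | l) hl
      · rfl
      · have := (hIoc _ (hl.trans hi')).1
        rw [freePos_inr_val] at this
        omega

open Classical in
lemma prod_integral_limitMeasure {ρ : Fin 2 → Measure ℝ} {n m : ℕ} (π : Pairing (m + n))
    (x : Fin 2) (s : Fin n ⊕ Fin m → ℝ) :
    ∏ v, ∫ e, Complex.exp (-Complex.I * (e * graphTime π v s : ℝ)) ∂(limitMeasure ρ π x v) =
      ∫ e, ∏ v with v ≠ rootClass π,
        oscKernel e (classTime (freeSign n m) (freeClass π) v s)
          ∂(ρ (if Even n then x else x + 1)) := by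
  rw [← Finset.mul_prod_erase _ _ (Finset.mem_univ (rootClass π))]
  have h1 : ∀ v ∈ Finset.univ.erase (rootClass π),
      ∫ e, Complex.exp (-Complex.I * (e * graphTime π v s : ℝ)) ∂(limitMeasure ρ π x v) =
        levelFourier (classTime (freeSign n m) (freeClass π) v s) := by
    intro v hv
    have hv' := Finset.ne_of_mem_erase hv
    simp only [limitMeasure, if_neg hv', graphTime, phaseTime, levelFourier]
  rw [Finset.prod_congr rfl h1, limitMeasure, if_pos rfl, ← integral_mul_const]
  congr 1
  ext e
  simp only [oscKernel]
  rw [Finset.prod_mul_distrib, ← Complex.exp_sum]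
  congr 1
  · simp only [graphTime, phaseTime, if_true]
    congr 1
    rw [← Finset.mul_sum]
    push_cast
    rw [← Finset.mul_sum]
    ring
  · exact Finset.prod_congr (by ext; simp) fun _ _ => rfl

lemma norm_limitContribution_le {ε : ℝ} (hε : 0 < ε) {ψ : (N : ℕ) → Fin 2 × Fin N → ℂ}
    {ρ : Fin 2 → Measure ℝ} (h : IsInitialData ε ψ ρ) {n m : ℕ} {π : Pairing (m + n)}
    (hπ : IsNested m π) (x : Fin 2) {t : ℝ} (ht : 2 ≤ t) (lam : ℝ) :
    ‖limitContribution ρ π x t lam‖ ≤ |lam| ^ (n + m) * (10 / ε *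
      ((12 * Real.log t) ^ π.openings.card * t ^ (π.openings.card - 1))) := by
  classical
  have := h.finite
  have hlog : 0 ≤ Real.log t := Real.log_nonneg (by linarith)
  set ρ' := ρ (if Even n then x else x + 1) with hρ'
  set U : Finset (EnergyVar π) := Finset.univ.filter fun v => v ≠ rootClass π with hU
  have hcard : U.card = π.openings.card := by
    rw [← EnergyVar.card_ne_mk_last hπ.1, hU, rootClass_eq_last]
  obtain ⟨j₁, j₂, hj, hcls, hroot, hsame⟩ := hπ.exists_freeClass
  obtain ⟨A, L, hAL⟩ := exists_mem_timeDomain_iff n m t j₁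
  have hbound : ∀ e ∈ Set.Icc ε (1 - ε), ‖∫ s in timeDomain n m t, ∏ v ∈ U,
      oscKernel e (classTime (freeSign n m) (freeClass π) v s)‖ ≤ 10 / ε *
        ((12 * Real.log t) ^ π.openings.card * t ^ (π.openings.card - 1)) := by
    intro e he
    refine (norm_setIntegral_prod_oscKernel_le (isCompact_timeDomain n m t) hAL
      (timeDomain_subset_Icc n m t) ?_ U ?_ hsame ?_ hε he ht).trans (le_of_eq ?_)
    · rintro (j | j)
      exacts [Or.inl rfl, Or.inr rfl]
    · simpa [hU] using hroot
    · intro v hv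
      rcases eq_or_ne v (freeClass π j₁) with rfl | hne
      · exact ⟨j₂, hj, hcls⟩
      · obtain ⟨j, rfl⟩ := exists_freeClass_eq (by simpa [hU] using hv)
        exact ⟨j, fun h => hne (by rw [h]), rfl⟩
    · have h2 := π.two_mul_card_openings
      rw [hcard, Fintype.card_sum, Fintype.card_fin, Fintype.card_fin,
        show n + m - 1 - π.openings.card = π.openings.card - 1 by omega]
  rw [limitContribution_eq_integral h.finite π x (by linarith) lam, norm_mul, norm_mul,
    norm_amplitudePrefactor, one_mul, norm_pow, Complex.norm_real, Real.norm_eq_abs]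
  refine mul_le_mul_of_nonneg_left ?_ (by positivity)
  simp only [prod_integral_limitMeasure]
  rw [integral_integral_swap]
  · refine (norm_integral_le_of_norm_le_const ((h.ae_mem_Icc _).mono hbound)).trans ?_
    exact mul_le_of_le_one_right (by positivity) (h.measureReal_univ_le_one _)
  · refine Integrable.of_bound (C := 1) (Continuous.aestronglyMeasurable ?_)
      (Eventually.of_forall fun p => ?_)
    · simp only [Function.uncurry_def, oscKernel]
      fun_prop
    · simp only [Function.uncurry_def, norm_prod, norm_oscKernel]
      exact Finset.prod_le_one (fun _ _ => norm_nonneg _) fun v _ => norm_levelFourier_le_one _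

/-- The constant of the bound for nested graphs. -/
noncomputable def nestedConstant (ε : ℝ) : ℝ := 12 * (1 + 80 / ε)

lemma nestedConstant_pos {ε : ℝ} (hε : 0 < ε) : 0 < nestedConstant ε := by
  unfold nestedConstant
  positivity

lemma norm_limitContribution_le_of_eq {ε : ℝ} (hε : 0 < ε) {ψ : (N : ℕ) → Fin 2 × Fin N → ℂ}
    {ρ : Fin 2 → Measure ℝ} (h : IsInitialData ε ψ ρ) {n m : ℕ} {π : Pairing (m + n)}
    (hπ : IsNested m π) (x : Fin 2) {t lam T : ℝ} (ht : 2 ≤ t) (hT : lam ^ 2 * t = T) :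
    ‖limitContribution ρ π x t lam‖ ≤
      (nestedConstant ε * T) ^ ((n + m) / 2) * Real.log t ^ (3 + (n + m) / 2) / t := by
  have hk := π.two_mul_card_openings
  have hk0 : 0 < π.openings.card := by
    obtain ⟨-, a, -⟩ := hπ.2
    have := a.2
    omega
  refine (norm_limitContribution_le hε h hπ x ht lam).trans ?_
  rw [show (n + m) / 2 = π.openings.card by omega, show n + m = 2 * π.openings.card by omega]
  obtain ⟨k, hk'⟩ : ∃ k, π.openings.card = k + 1 := ⟨_, (Nat.succ_pred_eq_of_pos hk0).symm⟩
  rw [hk', Nat.add_sub_cancel]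
  have ht0 : 0 < t := by linarith
  have hlog : 1 / 2 ≤ Real.log t :=
    (by linarith [Real.log_two_gt_d9] : 1 / 2 ≤ Real.log 2).trans
      (Real.log_le_log (by norm_num) ht)
  have hlog3 : 1 / 8 ≤ Real.log t ^ 3 := by
    calc (1 : ℝ) / 8 = (1 / 2) ^ 3 := by norm_num
      _ ≤ _ := by gcongr
  have hT0 : 0 ≤ T := hT ▸ by positivity
  have hconst : 10 / ε ≤ (1 + 80 / ε) ^ (k + 1) * Real.log t ^ 3 := by
    have h1 : 1 + 80 / ε ≤ (1 + 80 / ε) ^ (k + 1) :=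
      le_self_pow₀ (by linarith [div_pos (by norm_num : (0 : ℝ) < 80) hε]) (Nat.succ_ne_zero k)
    calc 10 / ε ≤ (1 + 80 / ε) * (1 / 8) := by ring_nf; linarith
      _ ≤ _ := by gcongr
  rw [le_div_iff₀ ht0, pow_mul, sq_abs]
  calc (lam ^ 2) ^ (k + 1) * (10 / ε * ((12 * Real.log t) ^ (k + 1) * t ^ k)) * t
      = 10 / ε * ((12 * (lam ^ 2 * t)) ^ (k + 1) * Real.log t ^ (k + 1)) := by ring
    _ ≤ (1 + 80 / ε) ^ (k + 1) * Real.log t ^ 3 *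
        ((12 * (lam ^ 2 * t)) ^ (k + 1) * Real.log t ^ (k + 1)) := by gcongr
    _ = (nestedConstant ε * T) ^ (k + 1) * Real.log t ^ (3 + (k + 1)) := by
        rw [hT, nestedConstant]
        simp only [mul_pow]
        ring

lemma tendsto_limitContribution {ε : ℝ} (hε : 0 < ε) {ψ : (N : ℕ) → Fin 2 × Fin N → ℂ}
    {ρ : Fin 2 → Measure ℝ} (h : IsInitialData ε ψ ρ) {n m : ℕ} {π : Pairing (m + n)}
    (hπ : IsNested m π) (x : Fin 2) {T : ℝ} {lam : ℝ → ℝ} (hT : ∀ t, 0 < t → lam t ^ 2 * t = T) :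
    Tendsto (fun t => limitContribution ρ π x t (lam t)) atTop (𝓝 0) := by
  have hlim := (Real.isLittleO_pow_log_id_atTop (n := 3 + (n + m) / 2)).tendsto_div_nhds_zero.const_mul
    ((nestedConstant ε * T) ^ ((n + m) / 2))
  rw [mul_zero] at hlim
  refine squeeze_zero_norm' ?_ hlim
  filter_upwards [eventually_ge_atTop 2] with t ht
  rw [id, ← mul_div_assoc]
  exact norm_limitContribution_le_of_eq hε h hπ x ht (hT t (by linarith))

end HoppingModel

theorem mainTheorem3 (ε : ℝ) (hε : 0 < ε) :
    ∃ C : ℝ, 0 < C ∧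
      ∀ (ψ : (N : ℕ) → Fin 2 × Fin N → ℂ) (ρ : Fin 2 → Measure ℝ),
        HoppingModel.IsInitialData ε ψ ρ →
        -- the limit `N → ∞` exists, graph by graph and for the total nested contribution
        (∀ (n m : ℕ) (π : HoppingModel.Pairing (m + n)), HoppingModel.IsNested m π →
          ∀ (x : Fin 2) (t lam : ℝ), 0 ≤ t →
            Tendsto (fun N => HoppingModel.graphContribution (ψ N) π x t lam) atTop
              (𝓝 (HoppingModel.limitContribution ρ π x t lam))) ∧
        (∀ (M : ℕ) (x : Fin 2) (t lam : ℝ), 0 ≤ t →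
            Tendsto (fun N => HoppingModel.nestedContribution (ψ N) M x t lam) atTop
              (𝓝 (HoppingModel.nestedLimit ρ M x t lam))) ∧
        -- the bound for each nested graph
        (∀ (n m : ℕ) (π : HoppingModel.Pairing (m + n)), HoppingModel.IsNested m π →
          ∀ (x : Fin 2) (t lam T : ℝ), 2 ≤ t → lam ^ 2 * t = T →
            ‖HoppingModel.limitContribution ρ π x t lam‖ ≤
              (C * T) ^ ((n + m) / 2) * Real.log t ^ (3 + (n + m) / 2) / t) ∧
        -- the total nested contribution vanishes in the Van Hove limit
        (∀ (M : ℕ) (x : Fin 2) (T : ℝ) (lam : ℝ → ℝ), (∀ t, 0 < t → lam t ^ 2 * t = T) →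
            Tendsto (fun t => HoppingModel.nestedLimit ρ M x t (lam t)) atTop (𝓝 0)) := by
  classical
  refine ⟨HoppingModel.nestedConstant ε, HoppingModel.nestedConstant_pos hε, fun ψ ρ h =>
    ⟨fun n m π hπ x t lam ht => HoppingModel.tendsto_graphContribution h hπ.1 x ht lam,
      fun M x t lam ht => ?_,
      fun n m π hπ x t lam T ht hT => HoppingModel.norm_limitContribution_le_of_eq hε h hπ x ht hT,
      fun M x T lam hT => ?_⟩⟩
  · refine tendsto_finsetSum _ fun n _ => tendsto_finsetSum _ fun m _ =>
      tendsto_finsetSum _ fun π hπ => ?_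
    exact HoppingModel.tendsto_graphContribution h (Finset.mem_filter.1 hπ).2.1 x ht lam
  · have hsum := tendsto_finsetSum (Finset.range (M + 1)) fun n _ =>
      tendsto_finsetSum (Finset.range (M + 1)) fun m _ =>
        tendsto_finsetSum (f := fun (π : HoppingModel.Pairing (m + n)) t =>
            HoppingModel.limitContribution ρ π x t (lam t)) (a := fun _ => 0)
          (Finset.univ.filter fun π : HoppingModel.Pairing (m + n) => HoppingModel.IsNested m π)
          fun π hπ => HoppingModel.tendsto_limitContribution hε h (Finset.mem_filter.1 hπ).2 x hT
    simp only [Finset.sum_const_zero] at hsum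
    exact hsum
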